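/- Let $(X,d)$ be a complete, path-connected length space; that is, a complete metric space in which any two points are joined by a continuous path and $d(x,y)$ is the infimum of the lengths of the curves from $x$ to $y$, for all $x,y\in X$. A geodesic from $x$ to $y$ is a map $\gamma:[0,1]\to X$ with $\gamma(0)=x$, $\gamma(1)=y$ and $d(\gamma(s),\gamma(t))=\lambda|s-t|$ for all $s,t$, for some constant $\lambda\ge 0$. A set $U\subseteq X$ is geodesically convex if any two points of $U$ are joined by a geodesic contained in $U$; the metric on such a $U$ is convex if $d(\gamma_1(t),\gamma_2(t))\le(1-t)\,d(\gamma_1(0),\gamma_2(0))+t\,d(\gamma_1(1),\gamma_2(1))$ for all geodesics $\gamma_1,\gamma_2:[0,1]\to U$ and all $t\in[0,1]$. The metric $d$ is locally convex if every point has a geodesically convex neighborhood on which the metric is convex, and globally convex if this holds for $U=X$. A CAT(0) space is a metric space in which any two points are joined by a geodesic, and in which for every geodesic triangle $\Delta$ with a comparison triangle $\overline\Delta\subset\mathbb{E}^2$ having the same side lengths, $d(p,q)\le d(\overline p,\overline q)$ for all $p,q\in\Delta$ with comparison points $\overline p,\overline q\in\overline\Delta$. The space $X$ is locally CAT(0)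 if for every $x\in X$ some open ball $B(x,r)$, $r>0$, is a CAT(0) space with the induced metric. A universal cover of $X$ is a covering map $p:\tilde X\to X$ with $\tilde X$ simply connected. A map $p$ of metric spaces is a local isometry if every point $\tilde x$ of the domain has an open ball $B(\tilde x,r)$, $r>0$, that $p$ maps isometrically onto $B(p(\tilde x),r)$. **Theorem (Cartan–Hadamard).** Let $p:\tilde X\to X$ be a universal cover of $X$. 1. There is a unique metric $\tilde d$ on $\tilde X$, inducing the topology of $\tilde X$, such that $(\tilde X,\tilde d)$ is a length space and $p:(\tilde X,\tilde d)\to(X,d)$ is a local isometry. 2. If $d$ is locally convex, then $\tilde d$ is globally convex. 3. If $d$ is locally convex, then $(\tilde X,\tilde d)$ is uniquely geodesic: any two points are joined by exactly one geodesic. 4. If $X$ is locally CAT(0), then $(\tilde X,\tilde d)$ is a CAT(0) space. Moreover, if $d$ is locally convex or $X$ is locally CAT(0), then a universal cover of $X$ exists. -/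

import Mathlib

open Set Topology
open scoped unitInterval

universe u v

/-- A length space: the distance between two points is the infimum of the lengths of the curves
joining them. The length of a curve, i.e. the supremum over all partitions of the sum of the
distances of consecutive points, is `eVariationOn`; non-rectifiable curves have length `∞` and do
not affect the infimum. -/
def IsLengthSpace (X : Type u) [MetricSpace X] : Prop :=
  ∀ x y : X, edist x y = ⨅ γ : Path x y, eVariationOn (γ : I → X) univ

/-- A geodesic `[0,1] → X`, parametrized proportionally to arc length (constant curves are
allowed). -/
def IsGeodesic {X : Type u} [MetricSpace X] (γ : I → X) : Prop :=
  ∃ c : ℝ, 0 ≤ c ∧ ∀ s t : I, dist (γ s) (γ t) = c * |(s : ℝ) - (t : ℝ)|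

/-- `γ` is a geodesic from `x` to `y`. -/
structure IsGeodesicFromTo {X : Type u} [MetricSpace X] (γ : I → X) (x y : X) : Prop where
  isGeodesic : IsGeodesic γ
  source : γ 0 = x
  target : γ 1 = y

/-- Any two points are joined by a geodesic. -/
def IsGeodesicSpace (X : Type u) [MetricSpace X] : Prop :=
  ∀ x y : X, ∃ γ : I → X, IsGeodesicFromTo γ x y

/-- Any two points are joined by exactly one geodesic. -/
def IsUniquelyGeodesic (X : Type u) [MetricSpace X] : Prop :=
  ∀ x y : X, ∃! γ : I → X, IsGeodesicFromTo γ x y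

/-- Any two points of `U` are joined by a geodesic contained in `U`. -/
def IsGeodesicallyConvex {X : Type u} [MetricSpace X] (U : Set X) : Prop :=
  ∀ x ∈ U, ∀ y ∈ U, ∃ γ : I → X, IsGeodesicFromTo γ x y ∧ ∀ t, γ t ∈ U

/-- `U` is geodesically convex and the induced metric on `U` is convex: along any two geodesics in
`U`, parametrized proportionally to arc length on `[0,1]`, the distance is bounded by the linear
interpolation of its boundary values. -/
def IsConvexMetricOn {X : Type u} [MetricSpace X] (U : Set X) : Prop :=
  IsGeodesicallyConvex U ∧
    ∀ γ₁ γ₂ : I → X, IsGeodesic γ₁ → IsGeodesic γ₂ → (∀ t, γ₁ t ∈ U) → (∀ t, γ₂ t ∈ U) →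
      ∀ t : I, dist (γ₁ t) (γ₂ t) ≤
        (1 - (t : ℝ)) * dist (γ₁ 0) (γ₂ 0) + (t : ℝ) * dist (γ₁ 1) (γ₂ 1)

/-- Every point has a geodesically convex neighborhood on which the induced metric is convex. -/
def IsLocallyConvexMetric (X : Type u) [MetricSpace X] : Prop :=
  ∀ x : X, ∃ U ∈ 𝓝 x, IsConvexMetricOn U

/-- The whole space is geodesic and its metric is convex. -/
def IsGloballyConvexMetric (X : Type u) [MetricSpace X] : Prop :=
  IsConvexMetricOn (univ : Set X)

/-- The Euclidean plane. -/
abbrev EPlane : Type := EuclideanSpace ℝ (Fin 2)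

/-- `γ 0`, `γ 1`, `γ 2` are the sides of a geodesic triangle with vertices `v 0`, `v 1`, `v 2`; the
side `γ i` runs from `v i` to `v (i + 1)`, indices modulo 3. -/
def IsGeodesicTriangle {X : Type u} [MetricSpace X] (v : Fin 3 → X) (γ : Fin 3 → I → X) : Prop :=
  ∀ i, IsGeodesicFromTo (γ i) (v i) (v (i + 1))

/-- `w` is the vertex set of a comparison triangle in the plane for vertices `v`. -/
def IsComparisonTriangle {X : Type u} [MetricSpace X] (v : Fin 3 → X) (w : Fin 3 → EPlane) :
    Prop :=
  ∀ i j, dist (w i) (w j) = dist (v i) (v j)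

/-- A CAT(0) space: a geodesic space all of whose geodesic triangles satisfy the CAT(0) inequality.
As sides have constant speed, the comparison point of `γ i s` on the side from `w i` to `w (i + 1)`
is `AffineMap.lineMap (w i) (w (i + 1)) s`. -/
def IsCAT0 (X : Type u) [MetricSpace X] : Prop :=
  IsGeodesicSpace X ∧
    ∀ (v : Fin 3 → X) (γ : Fin 3 → I → X) (w : Fin 3 → EPlane),
      IsGeodesicTriangle v γ → IsComparisonTriangle v w →
        ∀ (i j : Fin 3) (s t : I), dist (γ i s) (γ j t) ≤
          dist (AffineMap.lineMap (w i) (w (i + 1)) (s : ℝ) : EPlane)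
            (AffineMap.lineMap (w j) (w (j + 1)) (t : ℝ) : EPlane)

/-- Every point is the center of an open ball that is CAT(0) in the induced metric. -/
def IsLocallyCAT0 (X : Type u) [MetricSpace X] : Prop :=
  ∀ x : X, ∃ r > 0, IsCAT0 (Metric.ball x r)

/-- A local isometry: around each point some open ball is mapped isometrically onto the open ball
of the same radius around the image. -/
def IsLocalIsometry {E : Type v} {X : Type u} [MetricSpace E] [MetricSpace X] (f : E → X) : Prop :=
  ∀ x : E, ∃ r > 0,
    (∀ y ∈ Metric.ball x r, ∀ z ∈ Metric.ball x r, dist (f y) (f z) = dist y z) ∧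
      f '' Metric.ball x r = Metric.ball (f x) r

/-- `p : E → X` is a universal cover: a covering map with simply connected (in particular nonempty
and path-connected) total space. -/
structure IsUniversalCover {E : Type v} {X : Type u} [TopologicalSpace E] [TopologicalSpace X]
    (p : E → X) : Prop where
  isCoveringMap : IsCoveringMap p
  simplyConnected : SimplyConnectedSpace E

/-- `m` is a metric on the topological space `E` (i.e. it induces the given topology), it is a
length metric, and it makes `p` a local isometry. -/
structure IsLiftedLengthMetric {E : Type v} {X : Type u} [tE : TopologicalSpace E] [MetricSpace X]
    (p : E → X) (m : MetricSpace E) : Prop where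
  topology_eq : m.toPseudoMetricSpace.toUniformSpace.toTopologicalSpace = tE
  isLengthSpace : @IsLengthSpace E m
  isLocalIsometry : @IsLocalIsometry E X m _ p

/-!
# The Cartan–Hadamard theorem for locally convex and locally CAT(0) spaces

The cover. Fix `x₀ : X` and consider the space `localGeodesicsFrom x₀` of local geodesics
`[0,1] → X` with origin `x₀`, with the uniform metric, together with the exponential map
`geodesicExp x₀` sending a local geodesic to its endpoint. In a locally convex space, the distance
between two nearby local geodesics is a convex function of the parameter (`IsLocalGeodesic.dist_le`,
a maximum principle), so that the exponential map is injective and distance preserving near each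
local geodesic. It is also locally onto: a local geodesic is subdivided into short pieces, and the
nearby local geodesic with a prescribed endpoint is the limit of the iterated replacement of each
division point by the midpoint of its neighbours (`exists_discrete_geodesic`,
`IsLocalGeodesic.exists_near`). Hence the exponential map is a local isometry. Its domain is
complete, being closed in `C(I, X)`, and contractible, as local geodesics can be shrunk to their
origin. A local isometry from a complete space to a locally convex one is a covering map
(`IsLocalIsometry.isCoveringMap`): short geodesics lift, and give the sheets. So the exponential
map is a universal cover.

The metric. On any connected covering space `E` of a length space, the only candidate for the
metric is the infimum of the lengths of the projections of the paths joining two points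
(`liftedEDist`), because a local isometry preserves lengths of curves. Over a small ball this is the
distance of the projections (`IsCoveringMap.exists_sheet`), from which the asserted properties and
the completeness of `E` follow.

Global convexity. A simply connected complete length space with a locally convex metric has a
section of its own exponential covering, so that there is exactly one local geodesic between any two
points, depending continuously on its ends. Summing the infinitesimal convexity estimate along a
nearly shortest curve between the endpoints shows that local geodesics with a common origin spread
at most linearly (`IsLocalGeodesic.dist_le_of_simplyConnected`). It follows that local geodesics are
geodesics, and that the metric is globally convex; uniqueness of geodesics is a formal consequence.

CAT(0). The CAT(0) condition is equivalent to the CN inequality, the comparison of the distances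
from a vertex to the points of the opposite side, on convex sets (`IsCAT0.isCNOn`,
`IsCNOn.isCAT0`). It implies convexity, so locally CAT(0) spaces are locally convex. In a globally
convex space the CN inequality is local: for a thin triangle it is obtained by gluing a chain of
small quadrilaterals (`exists_thin_triangle`), and the general case follows from the maximum
principle, as the inequality only has to be tested at midpoints of short pieces of the side.
-/

/-! ### Convexity from midpoints, and variation from small scales -/

/-- A continuous function on `[0,1]` that satisfies, at every interior point, the midpoint
inequality for *some* symmetric pair of points around it lies below its chord. This is the maximum
principle: the leftmost maximum of the difference with the chord cannot be interior. -/
theorem le_chord_of_midpoint_le {f : I → ℝ} (hf : Continuous f)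
    (h : ∀ t : I, 0 < t → t < 1 → ∃ a b : I, a < t ∧ (t : ℝ) = (a + b) / 2 ∧
      2 * f t ≤ f a + f b) (t : I) :
    f t ≤ (1 - (t : ℝ)) * f 0 + t * f 1 := by
  set g : I → ℝ := fun t => f t - ((1 - (t : ℝ)) * f 0 + t * f 1) with hg
  have hgc : Continuous g := by fun_prop
  obtain ⟨m, -, hm⟩ := isCompact_univ.exists_isMaxOn univ_nonempty hgc.continuousOn
  have hm' : ∀ s, g s ≤ g m := fun s => hm (mem_univ s)
  have hK : IsCompact {s | g s = g m} := (isClosed_eq hgc continuous_const).isCompact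
  obtain ⟨l, hl, hlmin⟩ := hK.exists_isLeast ⟨m, rfl⟩
  have hl' : g l = g m := hl
  have key : g l ≤ 0 := by
    rcases eq_or_ne l 0 with rfl | h0
    · simp [hg]
    rcases eq_or_ne l 1 with rfl | h1
    · simp [hg]
    obtain ⟨a, b, hal, hmid, hle⟩ := h l (unitInterval.pos_iff_ne_zero.2 h0)
      (unitInterval.lt_one_iff_ne_one.2 h1)
    have ha : g a < g m := lt_of_le_of_ne (hm' a) fun e => absurd (hlmin e) (not_le.2 hal)
    have hb := hm' b
    exfalso
    simp only [hg] at ha hb hl'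
    rw [hmid] at hl'
    nlinarith
  have := hm' t
  simp only [hg] at this key hl'
  linarith

theorem eVariationOn_le_mul_of_edist_le {α E F : Type*} [LinearOrder α] [PseudoEMetricSpace E]
    [PseudoEMetricSpace F] {f : α → E} {g : α → F} {C : ENNReal} {s : Set α}
    (h : ∀ a ∈ s, ∀ b ∈ s, edist (f a) (f b) ≤ C * edist (g a) (g b)) :
    eVariationOn f s ≤ C * eVariationOn g s := by
  refine iSup_le fun ⟨n, w, hw, hws⟩ => ?_
  calc ∑ i ∈ Finset.range n, edist (f (w (i + 1))) (f (w i))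
      ≤ ∑ i ∈ Finset.range n, C * edist (g (w (i + 1))) (g (w i)) :=
        Finset.sum_le_sum fun i _ => h _ (hws _) _ (hws _)
    _ = C * ∑ i ∈ Finset.range n, edist (g (w (i + 1))) (g (w i)) := by rw [Finset.mul_sum]
    _ ≤ C * eVariationOn g s := by gcongr; exact eVariationOn.sum_le hw hws

/-- Lengths of curves can be compared at small scales. -/
theorem eVariationOn_univ_le_mul_of_edist_le {E F : Type*} [PseudoEMetricSpace E]
    [PseudoEMetricSpace F] {f : I → E} {g : I → F} {C : ENNReal} {δ : ℝ} (hδ : 0 < δ)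
    (h : ∀ a b : I, |(a : ℝ) - b| ≤ δ → edist (f a) (f b) ≤ C * edist (g a) (g b)) :
    eVariationOn f univ ≤ C * eVariationOn g univ := by
  have h01 : (0 : ℝ) ≤ 1 := zero_le_one
  let τ : ℕ → I := Set.Icc.addNSMul h01 δ
  have hτ : Monotone τ := Set.Icc.monotone_addNSMul h01 hδ.le
  obtain ⟨n, hn⟩ := Set.Icc.addNSMul_eq_right h01 hδ
  have h0 : τ 0 = 0 := Subtype.ext (Set.Icc.addNSMul_zero h01)
  have h1 : τ n = 1 := Subtype.ext (hn n le_rfl)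
  have hu : (univ : Set I) = Icc (τ 0) (τ n) := by rw [h0, h1]; exact unitInterval.univ_eq_Icc
  rw [hu, ← eVariationOn.sum' f hτ, ← eVariationOn.sum' g hτ, Finset.mul_sum]
  refine Finset.sum_le_sum fun i _ => eVariationOn_le_mul_of_edist_le fun a ha b hb => h a b ?_
  have e1 := Set.Icc.abs_sub_addNSMul_le h01 hδ.le i (t := τ (i + 1)) ⟨hτ (Nat.le_succ i), le_rfl⟩
  have e2 : (τ i : ℝ) ≤ a := ha.1
  have e3 : (a : ℝ) ≤ τ (i + 1) := ha.2
  have e4 : (τ i : ℝ) ≤ b := hb.1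
  have e5 : (b : ℝ) ≤ τ (i + 1) := hb.2
  have e6 : (τ (i + 1) : ℝ) - τ i ≤ δ := (le_abs_self _).trans e1
  rw [abs_le]; constructor <;> linarith

/-! ### Geodesic segments and convexity -/

section Convexity

variable {X : Type u} [MetricSpace X]

/-- `γ` has constant speed `c` on `s` and is distance-realizing there. -/
def HasSpeedOn (γ : I → X) (c : ℝ) (s : Set I) : Prop :=
  ∀ a ∈ s, ∀ b ∈ s, dist (γ a) (γ b) = c * |(a : ℝ) - b|

theorem HasSpeedOn.isGeodesic_comp_convexComb {γ : I → X} {c : ℝ} {a b : I} (hab : a ≤ b)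
    (hc : 0 ≤ c) (h : HasSpeedOn γ c (Icc a b)) :
    IsGeodesic fun t => γ (Set.Icc.convexComb a b t) := by
  have hab' : (0 : ℝ) ≤ b - a := sub_nonneg.2 hab
  refine ⟨c * (b - a), mul_nonneg hc hab', fun s t => ?_⟩
  rw [h _ ⟨Icc.le_convexComb hab s, Icc.convexComb_le hab s⟩ _
    ⟨Icc.le_convexComb hab t, Icc.convexComb_le hab t⟩]
  simp only [Icc.coe_convexComb]
  rw [show (1 - (s : ℝ)) * a + s * b - ((1 - t) * a + t * b) = (b - a) * (s - t) by ring, abs_mul,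
    abs_of_nonneg hab', mul_assoc]

theorem IsGeodesic.hasSpeedOn {γ : I → X} (h : IsGeodesic γ) :
    HasSpeedOn γ (dist (γ 0) (γ 1)) univ := by
  obtain ⟨c, hc, h⟩ := h
  have : dist (γ 0) (γ 1) = c := by simp [h]
  rw [this]
  exact fun a _ b _ => h a b

theorem IsGeodesic.dist_eq {γ : I → X} (h : IsGeodesic γ) (s t : I) :
    dist (γ s) (γ t) = dist (γ 0) (γ 1) * |(s : ℝ) - t| :=
  h.hasSpeedOn s trivial t trivial

theorem isGeodesic_const (x : X) : IsGeodesic fun _ : I => x :=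
  ⟨0, le_rfl, by simp⟩

theorem IsGeodesic.symm {γ : I → X} (h : IsGeodesic γ) :
    IsGeodesic fun t => γ (unitInterval.symm t) := by
  obtain ⟨c, hc, h⟩ := h
  refine ⟨c, hc, fun s t => ?_⟩
  rw [h, unitInterval.coe_symm_eq, unitInterval.coe_symm_eq, ← abs_neg]
  ring_nf

theorem IsConvexMetricOn.dist_convexComb_le {U : Set X} (hU : IsConvexMetricOn U) {γ₁ γ₂ : I → X}
    {c₁ c₂ : ℝ} {a₁ b₁ a₂ b₂ : I} (hab₁ : a₁ ≤ b₁) (hab₂ : a₂ ≤ b₂) (hc₁ : 0 ≤ c₁) (hc₂ : 0 ≤ c₂)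
    (h₁ : HasSpeedOn γ₁ c₁ (Icc a₁ b₁)) (h₂ : HasSpeedOn γ₂ c₂ (Icc a₂ b₂))
    (m₁ : ∀ t ∈ Icc a₁ b₁, γ₁ t ∈ U) (m₂ : ∀ t ∈ Icc a₂ b₂, γ₂ t ∈ U) (t : I) :
    dist (γ₁ (Icc.convexComb a₁ b₁ t)) (γ₂ (Icc.convexComb a₂ b₂ t)) ≤
      (1 - (t : ℝ)) * dist (γ₁ a₁) (γ₂ a₂) + t * dist (γ₁ b₁) (γ₂ b₂) := by
  have := hU.2 _ _ (h₁.isGeodesic_comp_convexComb hab₁ hc₁)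
    (h₂.isGeodesic_comp_convexComb hab₂ hc₂)
    (fun t => m₁ _ ⟨Icc.le_convexComb hab₁ t, Icc.convexComb_le hab₁ t⟩)
    (fun t => m₂ _ ⟨Icc.le_convexComb hab₂ t, Icc.convexComb_le hab₂ t⟩) t
  simpa using this

theorem IsConvexMetricOn.eq_of_endpoints {U : Set X} (hU : IsConvexMetricOn U) {γ₁ γ₂ : I → X}
    (h₁ : IsGeodesic γ₁) (h₂ : IsGeodesic γ₂) (m₁ : ∀ t, γ₁ t ∈ U) (m₂ : ∀ t, γ₂ t ∈ U)
    (h0 : γ₁ 0 = γ₂ 0) (h1 : γ₁ 1 = γ₂ 1) : γ₁ = γ₂ := by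
  funext t
  have := hU.2 γ₁ γ₂ h₁ h₂ m₁ m₂ t
  rw [h0, h1, dist_self, dist_self] at this
  exact dist_le_zero.1 (by simpa using this)

/-! ### Local geodesics -/

/-- A local geodesic `[0,1] → X`: parametrized proportionally to arc length and distance-realizing
at some uniform scale. By compactness of `[0,1]` the uniformity is no restriction. -/
def IsLocalGeodesic (γ : I → X) : Prop :=
  ∃ c : ℝ, 0 ≤ c ∧ ∃ δ > 0, ∀ s t : I, |(s : ℝ) - t| ≤ δ → dist (γ s) (γ t) = c * |(s : ℝ) - t|

theorem IsGeodesic.isLocalGeodesic {γ : I → X} (h : IsGeodesic γ) : IsLocalGeodesic γ := by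
  obtain ⟨c, hc, h⟩ := h
  exact ⟨c, hc, 1, one_pos, fun s t _ => h s t⟩

theorem IsLocalGeodesic.continuous {γ : I → X} (h : IsLocalGeodesic γ) : Continuous γ := by
  obtain ⟨c, hc, δ, hδ, h⟩ := h
  refine Metric.continuous_iff.2 fun t ε hε => ⟨min δ (ε / (c + 1)), by positivity, fun s hs => ?_⟩
  have hs' : |(s : ℝ) - t| < min δ (ε / (c + 1)) := by
    simpa [Subtype.dist_eq, Real.dist_eq] using hs
  rw [h s t (hs'.le.trans (min_le_left _ _))]
  have h2 := hs'.trans_le (min_le_right _ _)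
  rw [lt_div_iff₀ (by positivity)] at h2
  nlinarith [abs_nonneg ((s : ℝ) - t)]

theorem IsLocalGeodesic.comp_convexComb {γ : I → X} (h : IsLocalGeodesic γ) {a b : I}
    (hab : a ≤ b) : IsLocalGeodesic fun t => γ (Icc.convexComb a b t) := by
  obtain ⟨c, hc, δ, hδ, h⟩ := h
  have hab' : (0 : ℝ) ≤ b - a := sub_nonneg.2 hab
  have hba : (b : ℝ) - a ≤ 1 := by linarith [a.2.1, b.2.2]
  have key (s t : I) : |(Icc.convexComb a b s : ℝ) - Icc.convexComb a b t| =
      (b - a) * |(s : ℝ) - t| := by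
    simp only [Icc.coe_convexComb]
    rw [show (1 - (s : ℝ)) * a + s * b - ((1 - t) * a + t * b) = (b - a) * (s - t) by ring,
      abs_mul, abs_of_nonneg hab']
  refine ⟨c * (b - a), mul_nonneg hc hab', δ, hδ, fun s t hst => ?_⟩
  rw [h _ _, key, mul_assoc]
  rw [key]
  nlinarith [abs_nonneg ((s : ℝ) - t)]

/-- The distance between two local geodesics is convex, provided that near every parameter both
run in a common convex set. -/
theorem IsLocalGeodesic.dist_le {γ₁ γ₂ : I → X} (h₁ : IsLocalGeodesic γ₁)
    (h₂ : IsLocalGeodesic γ₂)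
    (h : ∀ t, ∃ U, IsConvexMetricOn U ∧ ∀ᶠ s in 𝓝 t, γ₁ s ∈ U ∧ γ₂ s ∈ U) (t : I) :
    dist (γ₁ t) (γ₂ t) ≤ (1 - (t : ℝ)) * dist (γ₁ 0) (γ₂ 0) + t * dist (γ₁ 1) (γ₂ 1) := by
  refine le_chord_of_midpoint_le (f := fun t => dist (γ₁ t) (γ₂ t))
    (h₁.continuous.dist h₂.continuous) (fun t ht0 ht1 => ?_) t
  obtain ⟨U, hU, hUt⟩ := h t
  obtain ⟨c₁, hc₁, δ₁, hδ₁, h₁⟩ := h₁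
  obtain ⟨c₂, hc₂, δ₂, hδ₂, h₂⟩ := h₂
  obtain ⟨r, hr, hrU⟩ := Metric.eventually_nhds_iff.1 hUt
  have ht0' : (0 : ℝ) < t := ht0
  have ht1' : (t : ℝ) < 1 := ht1
  obtain ⟨η, hη, hlt⟩ := exists_between (a₁ := (0 : ℝ))
    (a₂ := min (min (t : ℝ) (1 - t)) (min r (min (δ₁ / 2) (δ₂ / 2))))
    (by have : 0 < 1 - (t : ℝ) := by linarith
        positivity)
  simp only [lt_min_iff] at hlt
  obtain ⟨⟨g1, g2⟩, g3, g4, g5⟩ := hlt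
  let a : I := ⟨t - η, by linarith, by linarith⟩
  let b : I := ⟨t + η, by linarith, by linarith⟩
  have hab : a ≤ b := by change (t : ℝ) - η ≤ t + η; linarith
  have hmem : ∀ s ∈ Icc a b, |(s : ℝ) - t| ≤ η := by
    rintro s ⟨hs1, hs2⟩
    have hs1 : (t : ℝ) - η ≤ s := hs1
    have hs2 : (s : ℝ) ≤ t + η := hs2
    rw [abs_le]; constructor <;> linarith
  have hdist : ∀ s ∈ Icc a b, ∀ s' ∈ Icc a b, |(s : ℝ) - s'| ≤ 2 * η := by
    intro s hs s' hs'
    have e1 := abs_le.1 (hmem s hs)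
    have e2 := abs_le.1 (hmem s' hs')
    rw [abs_le]; constructor <;> linarith
  have hU' : ∀ s ∈ Icc a b, γ₁ s ∈ U ∧ γ₂ s ∈ U := fun s hs => hrU <| by
    rw [Subtype.dist_eq, Real.dist_eq]; linarith [hmem s hs]
  have e := hU.dist_convexComb_le hab hab hc₁ hc₂
    (fun s hs s' hs' => h₁ s s' (by linarith [hdist s hs s' hs']))
    (fun s hs s' hs' => h₂ s s' (by linarith [hdist s hs s' hs']))
    (fun s hs => (hU' s hs).1) (fun s hs => (hU' s hs).2) ⟨1 / 2, by norm_num, by norm_num⟩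
  have hmid : Icc.convexComb a b ⟨1 / 2, by norm_num, by norm_num⟩ = t := by
    ext; simp only [Icc.coe_convexComb, a, b]; ring
  rw [hmid] at e
  refine ⟨a, b, by change (t : ℝ) - η < t; linarith, by simp only [a, b]; ring, ?_⟩
  norm_num at e ⊢
  linarith

theorem IsLocalGeodesic.isGeodesic {γ : I → X} (h : IsLocalGeodesic γ) {U : Set X}
    (hU : IsConvexMetricOn U) (hγ : ∀ t, γ t ∈ U) : IsGeodesic γ := by
  obtain ⟨ρ, hρ, hρU⟩ := hU.1 _ (hγ 0) _ (hγ 1)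
  have : γ = ρ := funext fun t => by
    have := h.dist_le hρ.isGeodesic.isLocalGeodesic
      (fun t => ⟨U, hU, Filter.Eventually.of_forall fun s => ⟨hγ s, hρU s⟩⟩) t
    rw [hρ.source, hρ.target, dist_self, dist_self] at this
    exact dist_le_zero.1 (by simpa using this)
  exact this ▸ hρ.isGeodesic

/-- Along a compact curve in a locally convex space, balls of a uniform radius lie in convex
sets. -/
theorem IsLocallyConvexMetric.exists_ball_subset (hX : IsLocallyConvexMetric X) {K : Set X}
    (hK : IsCompact K) :
    ∃ ε > 0, ∀ x ∈ K, ∃ U, IsConvexMetricOn U ∧ Metric.ball x ε ⊆ U := by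
  choose U hU hUc using hX
  obtain ⟨ε, hε, h⟩ := lebesgue_number_lemma_of_metric hK (c := fun x => interior (U x))
    (fun _ => isOpen_interior) fun x _ => mem_iUnion.2 ⟨x, mem_interior_iff_mem_nhds.2 (hU x)⟩
  refine ⟨ε, hε, fun x hx => ?_⟩
  obtain ⟨y, hy⟩ := h x hx
  exact ⟨U y, hUc y, hy.trans interior_subset⟩

end Convexity

/-! ### Deforming local geodesics -/

section Deformation

variable {X : Type u} [MetricSpace X]

/-- A discrete Dirichlet problem: given midpoint maps `m i` that are convex on `U i` and a discrete
geodesic `v` for them, the right endpoint of `v` can be moved to a nearby point `y`. The averaging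
operator contracts distances weighted by the strictly concave function `j ↦ 1 + j (N - j)`, so its
iterates converge. -/
theorem exists_discrete_geodesic [CompleteSpace X] {N : ℕ} (hN : 0 < N) {b : ℝ} (hb : 0 ≤ b)
    {m : ℕ → X → X → X} {U : ℕ → Set X} {v : ℕ → X} {y : X}
    (hm : ∀ i, i + 1 < N → ∀ x ∈ U i, ∀ x' ∈ U i, ∀ z ∈ U i, ∀ z' ∈ U i,
      dist (m i x z) (m i x' z') ≤ (dist x x' + dist z z') / 2)
    (hv : ∀ i, i + 1 < N → m i (v i) (v (i + 2)) = v (i + 1))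
    (hU : ∀ i, i + 1 < N → ∀ x, dist (v i) x ≤ b → x ∈ U i)
    (hU' : ∀ i, i + 1 < N → ∀ x, dist (v (i + 2)) x ≤ b → x ∈ U i)
    (hy : dist (v N) y ≤ b) :
    ∃ w : ℕ → X, w 0 = v 0 ∧ w N = y ∧ (∀ j ≤ N, dist (v j) (w j) ≤ j / N * b) ∧
      ∀ i, i + 1 < N → w (i + 1) = m i (w i) (w (i + 2)) := by
  have hN' : (0 : ℝ) < N := by exact_mod_cast hN
  -- `T` replaces interior points by midpoints of their neighbours; the ends are fixed
  let T : (ℕ → X) → ℕ → X := fun w j =>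
    Nat.casesOn j (v 0) fun i => if i + 1 < N then m i (w i) (w (i + 2)) else y
  let w : ℕ → ℕ → X := fun n => T^[n] fun j => if j < N then v j else y
  have hw : ∀ n, w (n + 1) = T (w n) := fun n => Function.iterate_succ_apply' T n _
  have hT : ∀ n i, i + 1 < N → w (n + 1) (i + 1) = m i (w n i) (w n (i + 2)) := fun n i hi => by
    rw [hw]; exact if_pos hi
  have hw0 : ∀ n, w n 0 = v 0 := by
    rintro (_ | n)
    · exact if_pos hN
    · rw [hw]; rfl
  have hwN : ∀ n j, N ≤ j → w n j = y := by
    rintro (_ | n) j hj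
    · exact if_neg (by omega)
    · obtain ⟨i, rfl⟩ : ∃ i, j = i + 1 := ⟨j - 1, by omega⟩
      rw [hw]; exact if_neg (by omega)
  have hfrac : ∀ j ≤ N, (j : ℝ) / N * b ≤ b := fun j hj => by
    have : (j : ℝ) / N ≤ 1 := (div_le_one hN').2 (by exact_mod_cast hj)
    nlinarith
  have inv : ∀ n, ∀ j ≤ N, dist (v j) (w n j) ≤ j / N * b := by
    intro n
    induction n with
    | zero =>
      intro j hj
      rcases hj.lt_or_eq with h | rfl
      · have : w 0 j = v j := if_pos h
        rw [this, dist_self]; positivity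
      · rw [hwN _ _ le_rfl, div_self hN'.ne', one_mul]; exact hy
    | succ n ih =>
      intro j hj
      rcases hj.lt_or_eq with h | rfl
      · rcases j with _ | i
        · simp [hw0]
        · have h1 := ih i (by omega)
          have h2 := ih (i + 2) (by omega)
          have := hm i h _ (hU i h (v i) (by simpa using hb)) _
            (hU i h _ (h1.trans (hfrac _ (by omega)))) _ (hU' i h (v (i + 2)) (by simpa using hb)) _
            (hU' i h _ (h2.trans (hfrac _ (by omega))))
          rw [hv i h, ← hT n i h] at this
          refine this.trans ?_
          push_cast at h2 ⊢
          have e : ((i : ℝ) + 1) / N * b = (i / N * b + (i + 2) / N * b) / 2 := by field_simp; ring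
          rw [e]; linarith
      · rw [hwN _ _ le_rfl, div_self hN'.ne', one_mul]; exact hy
  have memU : ∀ n i, i + 1 < N → w n i ∈ U i := fun n i h =>
    hU i h _ ((inv n i (by omega)).trans (hfrac _ (by omega)))
  have memU' : ∀ n i, i + 1 < N → w n (i + 2) ∈ U i := fun n i h =>
    hU' i h _ ((inv n _ (by omega)).trans (hfrac _ (by omega)))
  -- `W` is at least `1`, and averaging the values at `i` and `i + 2` decreases it by `1`
  let W : ℕ → ℝ := fun j => 1 + j * (N - j)
  have hW1 : ∀ j ≤ N, 1 ≤ W j := fun j hj => by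
    have : (j : ℝ) ≤ N := by exact_mod_cast hj
    have : (0 : ℝ) ≤ j * (N - j) := mul_nonneg (by positivity) (by linarith)
    simp only [W]; linarith
  have hW2 : ∀ j ≤ N, W j ≤ 1 + (N : ℝ) ^ 2 := fun j hj => by
    have h1 : (j : ℝ) ≤ N := by exact_mod_cast hj
    have h2 : (0 : ℝ) ≤ j := by positivity
    simp only [W]; nlinarith
  let k : ℝ := 1 - 1 / (1 + (N : ℝ) ^ 2)
  have hk0 : 0 ≤ k := by
    have : 1 / (1 + (N : ℝ) ^ 2) ≤ 1 := by
      rw [div_le_one (by positivity)]; nlinarith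
    simp only [k]; linarith
  have hk1 : k < 1 := by
    have : 0 < 1 / (1 + (N : ℝ) ^ 2) := by positivity
    simp only [k]; linarith
  have hkW : ∀ j ≤ N, W j - 1 ≤ k * W j := fun j hj => by
    have : W j / (1 + (N : ℝ) ^ 2) ≤ 1 := (div_le_one (by positivity)).2 (hW2 j hj)
    have e : k * W j = W j - W j / (1 + (N : ℝ) ^ 2) := by simp only [k]; ring
    rw [e]; linarith
  have diff : ∀ n, ∀ j ≤ N, dist (w n j) (w (n + 1) j) ≤ 2 * b * W j * k ^ n := by
    intro n
    induction n with
    | zero =>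
      intro j hj
      have h1 := (inv 0 j hj).trans (hfrac j hj)
      have h2 := (inv 1 j hj).trans (hfrac j hj)
      have h3 := dist_triangle_left (w 0 j) (w (0 + 1) j) (v j)
      have := hW1 j hj
      rw [pow_zero, mul_one]
      nlinarith
    | succ n ih =>
      intro j hj
      have hpos : 0 ≤ 2 * b * W j * k ^ (n + 1) := by
        have := hW1 j hj
        positivity
      rcases hj.lt_or_eq with h | rfl
      · rcases j with _ | i
        · rw [hw0, hw0, dist_self]; exact hpos
        · have := hm i h _ (memU n i h) _ (memU (n + 1) i h) _ (memU' n i h) _ (memU' (n + 1) i h)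
          rw [← hT n i h, ← hT (n + 1) i h] at this
          refine this.trans ?_
          have h1 := ih i (by omega)
          have h2 := ih (i + 2) (by omega)
          have e : W i + W (i + 2) = 2 * (W (i + 1) - 1) := by simp only [W]; push_cast; ring
          have h3 := hkW (i + 1) hj
          have h4 : 0 ≤ 2 * b * k ^ n := by positivity
          calc _ ≤ (2 * b * W i * k ^ n + 2 * b * W (i + 2) * k ^ n) / 2 := by linarith
            _ = 2 * b * k ^ n * ((W i + W (i + 2)) / 2) := by ring
            _ = 2 * b * k ^ n * (W (i + 1) - 1) := by rw [e]; ring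
            _ ≤ 2 * b * k ^ n * (k * W (i + 1)) := by gcongr
            _ = _ := by ring
      · rw [hwN _ _ le_rfl, hwN _ _ le_rfl, dist_self]; exact hpos
  have lim : ∀ j, ∃ x, Filter.Tendsto (fun n => w n j) Filter.atTop (𝓝 x) := fun j => by
    rcases le_total j N with hj | hj
    · exact cauchySeq_tendsto_of_complete
        (cauchySeq_of_le_geometric k (2 * b * W j) hk1 fun n => diff n j hj)
    · exact ⟨y, by simpa only [hwN _ j hj] using tendsto_const_nhds⟩
  choose x hx using lim
  have hxv : ∀ j ≤ N, dist (v j) (x j) ≤ j / N * b := fun j hj =>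
    le_of_tendsto (tendsto_const_nhds.dist (hx j)) (Filter.Eventually.of_forall fun n => inv n j hj)
  refine ⟨x, ?_, ?_, hxv, fun i hi => ?_⟩
  · exact tendsto_nhds_unique (hx 0) (by simpa only [hw0] using tendsto_const_nhds)
  · exact tendsto_nhds_unique (hx N) (by simpa only [hwN _ N le_rfl] using tendsto_const_nhds)
  · refine tendsto_nhds_unique ((Filter.tendsto_add_atTop_iff_nat 1).2 (hx (i + 1))) ?_
    rw [tendsto_iff_dist_tendsto_zero]
    have h0 : Filter.Tendsto (fun n => (dist (w n i) (x i) + dist (w n (i + 2)) (x (i + 2))) / 2)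
        Filter.atTop (𝓝 0) := by
      have := ((tendsto_iff_dist_tendsto_zero.1 (hx i)).add
        (tendsto_iff_dist_tendsto_zero.1 (hx (i + 2)))).div_const 2
      simpa using this
    refine squeeze_zero (fun _ => dist_nonneg) (fun n => ?_) h0
    rw [hT n i hi]
    exact hm i hi _ (memU n i hi) _ (hU i hi _ ((hxv i (by omega)).trans (hfrac _ (by omega))))
      _ (memU' n i hi) _ (hU' i hi _ ((hxv _ (by omega)).trans (hfrac _ (by omega))))

/-- Geodesics `ρ i`, parametrized over `[i, i + 2]`, whose overlaps agree fit together to a local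
geodesic. -/
theorem exists_isLocalGeodesic_of_overlap {M : ℕ} {ρ : ℕ → I → X}
    (hρ : ∀ i ≤ M, IsGeodesic (ρ i))
    (hov : ∀ i < M, ∀ x : ℝ, i + 1 ≤ x → x ≤ i + 2 →
      ρ i (projIcc 0 1 zero_le_one ((x - i) / 2)) =
        ρ (i + 1) (projIcc 0 1 zero_le_one ((x - (i + 1)) / 2))) :
    ∃ γ : I → X, IsLocalGeodesic γ ∧ ∀ i ≤ M, ∀ t : I, (i : ℝ) ≤ (M + 2) * t →
      (M + 2) * (t : ℝ) ≤ i + 2 →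
        γ t = ρ i (projIcc 0 1 zero_le_one (((M + 2) * t - i) / 2)) := by
  have hM : (0 : ℝ) < M + 2 := by positivity
  let j : I → ℕ := fun t => min M ⌊(M + 2) * (t : ℝ)⌋₊
  let γ : I → X := fun t => ρ (j t) (projIcc 0 1 zero_le_one (((M + 2) * t - j t) / 2))
  have hγ : ∀ i ≤ M, ∀ t : I, (i : ℝ) ≤ (M + 2) * t → (M + 2) * (t : ℝ) ≤ i + 2 →
      γ t = ρ i (projIcc 0 1 zero_le_one (((M + 2) * t - i) / 2)) := by
    intro i hi t h1 h2
    have ht0 : 0 ≤ (M + 2) * (t : ℝ) := mul_nonneg hM.le t.2.1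
    have hj1 : i ≤ j t := le_min hi (Nat.le_floor h1)
    have hjM : j t ≤ M := min_le_left _ _
    have hj2 : (j t : ℝ) ≤ (M + 2) * t :=
      (Nat.cast_le.2 (min_le_right _ _)).trans (Nat.floor_le ht0)
    have hj3 : j t ≤ i + 2 := by exact_mod_cast hj2.trans h2
    have : j t = i ∨ j t = i + 1 ∨ j t = i + 2 := by omega
    rcases this with h | h | h <;> simp only [γ, h] <;> rw [h] at hj2 hjM <;> push_cast at hj2 ⊢
    · exact (hov i (by omega) _ hj2 h2).symm
    · have e : (M + 2) * (t : ℝ) = i + 2 := le_antisymm h2 hj2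
      have e1 := hov i (by omega) ((M + 2) * t) (by linarith) h2
      have e2 := hov (i + 1) (by omega) ((M + 2) * t) (by push_cast; linarith)
        (by push_cast; linarith)
      push_cast at e2
      rw [e1, e2]; congr 3; ring
  refine ⟨γ, ?_, hγ⟩
  have hproj : ∀ x : ℝ, 0 ≤ x → x ≤ 1 → ((projIcc 0 1 zero_le_one x : I) : ℝ) = x :=
    fun x h0 h1 => by rw [projIcc_of_mem zero_le_one ⟨h0, h1⟩]
  have hspeed : ∀ i ≤ M, dist (ρ i 0) (ρ i 1) = dist (ρ 0 0) (ρ 0 1) := by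
    intro i
    induction i with
    | zero => exact fun _ => rfl
    | succ i ih =>
      intro hi
      rw [← ih (by omega)]
      have e1 := hov i (by omega) (i + 1) le_rfl (by linarith)
      have e2 := hov i (by omega) (i + 2) (by linarith) le_rfl
      have e3 := (hρ i (by omega)).dist_eq (projIcc 0 1 zero_le_one (((i : ℝ) + 1 - i) / 2))
        (projIcc 0 1 zero_le_one (((i : ℝ) + 2 - i) / 2))
      rw [e1, e2, (hρ (i + 1) hi).dist_eq, hproj _ (by linarith) (by linarith),
        hproj _ (by linarith) (by linarith), hproj _ (by linarith) (by linarith),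
        hproj _ (by linarith) (by linarith)] at e3
      have a1 : ((i : ℝ) + 1 - (i + 1)) / 2 - (i + 2 - (i + 1)) / 2 = -(1 / 2) := by ring
      have a2 : ((i : ℝ) + 1 - i) / 2 - (i + 2 - i) / 2 = -(1 / 2) := by ring
      rw [a1, a2] at e3
      norm_num at e3 ⊢
      exact e3
  refine ⟨dist (ρ 0 0) (ρ 0 1) * ((M + 2) / 2), by positivity, 1 / (M + 2), by positivity, ?_⟩
  have main : ∀ s t : I, s ≤ t → |(s : ℝ) - t| ≤ 1 / (M + 2) →
      dist (γ s) (γ t) = dist (ρ 0 0) (ρ 0 1) * ((M + 2) / 2) * |(s : ℝ) - t| := by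
    intro s t hst' hd
    have hst : (s : ℝ) ≤ t := hst'
    have ht1 : (t : ℝ) ≤ 1 := t.2.2
    rw [abs_sub_comm, abs_of_nonneg (by linarith), le_div_iff₀ hM] at hd
    have hs0 : 0 ≤ (M + 2) * (s : ℝ) := mul_nonneg hM.le s.2.1
    obtain ⟨i, hi, h1, h2⟩ : ∃ i ≤ M, (i : ℝ) ≤ (M + 2) * s ∧ (M + 2) * (t : ℝ) ≤ i + 2 := by
      rcases le_total ⌊(M + 2) * (s : ℝ)⌋₊ M with h | h
      · refine ⟨_, h, Nat.floor_le hs0, ?_⟩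
        have := Nat.lt_floor_add_one ((M + 2) * (s : ℝ))
        nlinarith
      · exact ⟨M, le_rfl, (Nat.cast_le.2 h).trans (Nat.floor_le hs0), by nlinarith⟩
    have h3 : (M + 2) * (s : ℝ) ≤ (M + 2) * t := by gcongr
    rw [hγ i hi s h1 (by linarith), hγ i hi t (by linarith) h2, (hρ i hi).dist_eq, hspeed i hi,
      hproj _ (by linarith) (by linarith), hproj _ (by linarith) (by linarith), mul_assoc]
    congr 1
    rw [← abs_of_pos (show (0 : ℝ) < (M + 2) / 2 by positivity), ← abs_mul]
    congr 1; ring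
  intro s t hd
  rcases le_total s t with h | h
  · exact main s t h hd
  · rw [dist_comm, abs_sub_comm]; exact main t s h (by rwa [abs_sub_comm])

/-- A local geodesic can be deformed, through local geodesics with the same origin, so that its
endpoint becomes a prescribed nearby point; it then moves by no more than linear interpolation. -/
theorem IsLocalGeodesic.exists_near [CompleteSpace X] {γ : I → X} (h : IsLocalGeodesic γ) {ε : ℝ}
    (hε : 0 < ε) (hU : ∀ t, ∃ U, IsConvexMetricOn U ∧ Metric.ball (γ t) ε ⊆ U) {y : X}
    (hy : dist (γ 1) y < ε / 2) :
    ∃ γ' : I → X, IsLocalGeodesic γ' ∧ γ' 0 = γ 0 ∧ γ' 1 = y ∧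
      ∀ t, dist (γ t) (γ' t) ≤ t * dist (γ 1) y := by
  obtain ⟨c, hc, δ, hδ, hγ⟩ := h
  set b := dist (γ 1) y with hb
  have hb0 : 0 ≤ b := dist_nonneg
  obtain ⟨M, hM⟩ := exists_nat_gt (max (2 / δ) (2 * c / (ε / 2)))
  have hM0 : (0 : ℝ) < M + 2 := by positivity
  have hM1 : 2 / (M + 2 : ℝ) ≤ δ := by
    have := (le_max_left _ _).trans_lt hM
    rw [div_lt_iff₀ hδ] at this
    rw [div_le_iff₀ hM0]; nlinarith
  have hM2 : c * (2 / (M + 2)) < ε / 2 := by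
    have := (le_max_right _ _).trans_lt hM
    rw [div_lt_iff₀ (by positivity)] at this
    rw [← mul_div_assoc, div_lt_iff₀ hM0]; nlinarith
  -- the grid points `j / (M + 2)`
  let τ : ℕ → I := fun j => projIcc 0 1 zero_le_one (j / (M + 2) : ℝ)
  have hτ : ∀ j ≤ M + 2, (τ j : ℝ) = j / (M + 2) := fun j hj => by
    have hj' : (j : ℝ) ≤ M + 2 := by exact_mod_cast hj
    simp only [τ]
    rw [projIcc_of_mem zero_le_one ⟨by positivity, (div_le_one hM0).2 hj'⟩]
  have hτ0 : τ 0 = 0 := Subtype.ext (by rw [hτ 0 (by omega)]; simp)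
  have hτN : τ (M + 2) = 1 := Subtype.ext (by
    rw [hτ _ le_rfl]; push_cast; exact div_self hM0.ne')
  choose V hVc hVb using hU
  let U : ℕ → Set X := fun i => V (τ (i + 1))
  have hUc : ∀ i, IsConvexMetricOn (U i) := fun i => hVc _
  -- `γ` stays in `U i` on the whole double interval, with room `b`
  have hτle : ∀ i ≤ M, τ i ≤ τ (i + 2) := fun i hi => by
    change (τ i : ℝ) ≤ τ (i + 2)
    rw [hτ i (by omega), hτ (i + 2) (by omega)]; push_cast; gcongr; linarith
  have hmid : ∀ i ≤ M, ∀ t ∈ Icc (τ i) (τ (i + 2)), |(t : ℝ) - τ (i + 1)| ≤ 1 / (M + 2) := by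
    rintro i hi t ⟨h1, h2⟩
    have h1 : (τ i : ℝ) ≤ t := h1
    have h2 : (t : ℝ) ≤ τ (i + 2) := h2
    rw [hτ i (by omega)] at h1
    rw [hτ (i + 2) (by omega)] at h2
    rw [hτ (i + 1) (by omega)]
    push_cast at h2 ⊢
    rw [add_div] at h2 ⊢
    have : (2 : ℝ) / (M + 2) = 1 / (M + 2) + 1 / (M + 2) := by ring
    rw [abs_le]; constructor <;> linarith
  have hroom : ∀ i ≤ M, ∀ t ∈ Icc (τ i) (τ (i + 2)), ∀ x, dist (γ t) x ≤ b → x ∈ U i := by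
    intro i hi t ht x hx
    refine hVb _ ?_
    have h1 := hmid i hi t ht
    have h2 : (1 : ℝ) / (M + 2) ≤ 2 / (M + 2) := by gcongr; norm_num
    have h3 := hγ t (τ (i + 1)) (by linarith)
    have h4 : c * |(t : ℝ) - τ (i + 1)| ≤ c * (2 / (M + 2)) := by gcongr; linarith
    rw [Metric.mem_ball]
    have := dist_triangle_left x (γ (τ (i + 1))) (γ t)
    linarith
  have hspeed : ∀ i ≤ M, HasSpeedOn γ c (Icc (τ i) (τ (i + 2))) := by
    intro i hi s hs t ht
    refine hγ s t ?_
    have h1 := abs_le.1 (hmid i hi s hs)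
    have h2 := abs_le.1 (hmid i hi t ht)
    have : (2 : ℝ) / (M + 2) = 1 / (M + 2) + 1 / (M + 2) := by ring
    rw [abs_le]; constructor <;> linarith
  have hγU : ∀ i ≤ M, ∀ t ∈ Icc (τ i) (τ (i + 2)), γ t ∈ U i := fun i hi t ht =>
    hroom i hi t ht _ (by simpa using hb0)
  -- geodesics in `U i`
  have hg : ∀ i x z, ∃ g : I → X, x ∈ U i → z ∈ U i →
      IsGeodesicFromTo g x z ∧ ∀ t, g t ∈ U i := fun i x z => by
    by_cases hxz : x ∈ U i ∧ z ∈ U i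
    · obtain ⟨g, h⟩ := (hUc i).1 x hxz.1 z hxz.2
      exact ⟨g, fun _ _ => h⟩
    · exact ⟨fun _ => x, fun h1 h2 => (hxz ⟨h1, h2⟩).elim⟩
  choose g hg using hg
  let o : I := ⟨1 / 2, by norm_num, by norm_num⟩
  have ho : (o : ℝ) = 1 / 2 := rfl
  have hseg : ∀ i ≤ M, IsGeodesic fun s => γ (Icc.convexComb (τ i) (τ (i + 2)) s) :=
    fun i hi => (hspeed i hi).isGeodesic_comp_convexComb (hτle i hi) hc
  have hsegU : ∀ i ≤ M, ∀ s, γ (Icc.convexComb (τ i) (τ (i + 2)) s) ∈ U i := fun i hi s =>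
    hγU i hi _ ⟨Icc.le_convexComb (hτle i hi) s, Icc.convexComb_le (hτle i hi) s⟩
  have hend : ∀ i ≤ M, γ (τ i) ∈ U i ∧ γ (τ (i + 2)) ∈ U i := fun i hi =>
    ⟨hγU i hi _ ⟨le_rfl, hτle i hi⟩, hγU i hi _ ⟨hτle i hi, le_rfl⟩⟩
  have hgseg : ∀ i ≤ M, g i (γ (τ i)) (γ (τ (i + 2))) =
      fun s => γ (Icc.convexComb (τ i) (τ (i + 2)) s) := by
    intro i hi
    obtain ⟨h1, h2⟩ := hg i _ _ (hend i hi).1 (hend i hi).2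
    exact (hUc i).eq_of_endpoints h1.isGeodesic (hseg i hi) h2 (hsegU i hi)
      (by simp [h1.source]) (by simp [h1.target])
  have hτmid : ∀ i ≤ M, Icc.convexComb (τ i) (τ (i + 2)) o = τ (i + 1) := fun i hi => by
    ext
    rw [Icc.coe_convexComb, hτ i (by omega), hτ (i + 1) (by omega), hτ (i + 2) (by omega), ho]
    push_cast; ring
  obtain ⟨w, hw0, hwN, hwd, hwm⟩ := exists_discrete_geodesic (N := M + 2) (by omega) hb0
    (m := fun i x z => g i x z o) (U := U) (v := fun j => γ (τ j)) (y := y)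
    (fun i hi x hx x' hx' z hz z' hz' => by
      obtain ⟨h1, h2⟩ := hg i x z hx hz
      obtain ⟨h3, h4⟩ := hg i x' z' hx' hz'
      have := (hUc i).2 _ _ h1.isGeodesic h3.isGeodesic h2 h4 o
      rw [h1.source, h1.target, h3.source, h3.target, ho] at this
      linarith)
    (fun i hi => by
      have hi : i ≤ M := by omega
      simp only [hgseg i hi, hτmid i hi])
    (fun i hi => hroom i (by omega) _ ⟨le_rfl, hτle i (by omega)⟩)
    (fun i hi => hroom i (by omega) _ ⟨hτle i (by omega), le_rfl⟩)
    (by simp only [hτN]; exact hb.ge)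
  have hwb : ∀ j ≤ M + 2, dist (γ (τ j)) (w j) ≤ τ j * b := fun j hj => by
    have := hwd j hj
    rw [hτ j hj]; exact_mod_cast this
  have hwb' : ∀ j ≤ M + 2, dist (γ (τ j)) (w j) ≤ b := fun j hj =>
    (hwb j hj).trans (mul_le_of_le_one_left hb0 (τ j).2.2)
  -- the new geodesic pieces, over double intervals, with their estimates and overlaps
  let ρ : ℕ → I → X := fun i => g i (w i) (w (i + 2))
  have hρ : ∀ i ≤ M, IsGeodesicFromTo (ρ i) (w i) (w (i + 2)) ∧ ∀ t, ρ i t ∈ U i := fun i hi =>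
    hg i _ _ (hroom i hi _ ⟨le_rfl, hτle i hi⟩ _ (hwb' i (by omega)))
      (hroom i hi _ ⟨hτle i hi, le_rfl⟩ _ (hwb' _ (by omega)))
  have hρo : ∀ i ≤ M, ρ i o = w (i + 1) := fun i hi => (hwm i (by omega)).symm
  have hρd : ∀ i ≤ M, ∀ s, dist (γ (Icc.convexComb (τ i) (τ (i + 2)) s)) (ρ i s) ≤
      (Icc.convexComb (τ i) (τ (i + 2)) s : ℝ) * b := by
    intro i hi s
    obtain ⟨h1, h2⟩ := hρ i hi
    have := (hUc i).2 _ _ (hseg i hi) h1.isGeodesic (hsegU i hi) h2 s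
    simp only [Icc.convexComb_zero, Icc.convexComb_one, h1.source, h1.target] at this
    refine this.trans ?_
    rw [Icc.coe_convexComb, add_mul, mul_assoc, mul_assoc]
    exact add_le_add (mul_le_mul_of_nonneg_left (hwb i (by omega)) (by linarith [s.2.2]))
      (mul_le_mul_of_nonneg_left (hwb _ (by omega)) s.2.1)
  have hρhalf : ∀ i < M, ∀ s, ρ i (Icc.convexComb o 1 s) = ρ (i + 1) (Icc.convexComb 0 o s) := by
    intro i hi s
    obtain ⟨h1, h2⟩ := hρ i hi.le
    obtain ⟨h3, h4⟩ := hρ (i + 1) (by omega)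
    have ho1 : o ≤ 1 := unitInterval.le_one'
    have ho0 : 0 ≤ o := unitInterval.nonneg'
    refine congrFun ((hUc (i + 1)).eq_of_endpoints
      (γ₁ := fun s => ρ i (Icc.convexComb o 1 s)) (γ₂ := fun s => ρ (i + 1) (Icc.convexComb 0 o s))
      (HasSpeedOn.isGeodesic_comp_convexComb ho1 dist_nonneg
        fun a _ b _ => h1.isGeodesic.dist_eq a b)
      (HasSpeedOn.isGeodesic_comp_convexComb ho0 dist_nonneg
        fun a _ b _ => h3.isGeodesic.dist_eq a b) (fun s => ?_) (fun s => h4 _) ?_ ?_) s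
    · refine hroom (i + 1) (by omega)
        (Icc.convexComb (τ i) (τ (i + 2)) (Icc.convexComb o 1 s)) ⟨?_, ?_⟩ _
        ((hρd i hi.le _).trans (mul_le_of_le_one_left hb0
          (Icc.convexComb (τ i) (τ (i + 2)) (Icc.convexComb o 1 s)).2.2))
      · change (τ (i + 1) : ℝ) ≤ _
        simp only [Icc.coe_convexComb]
        rw [hτ i (by omega), hτ (i + 1) (by omega), hτ (i + 2) (by omega), ho]
        have : ((i + 1 : ℕ) : ℝ) / (M + 2) = i / (M + 2) + 1 / 2 * (2 / (M + 2)) := by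
          push_cast; ring
        have e : ((i + 2 : ℕ) : ℝ) / (M + 2) = i / (M + 2) + 2 / (M + 2) := by push_cast; ring
        rw [this, e, Icc.coe_one]
        have hp : (0 : ℝ) ≤ 2 / (M + 2) := by positivity
        nlinarith [s.2.1, mul_nonneg s.2.1 hp]
      · refine (Icc.convexComb_le (hτle i hi.le) _).trans ?_
        change (τ (i + 2) : ℝ) ≤ τ (i + 1 + 2)
        rw [hτ (i + 2) (by omega), hτ (i + 1 + 2) (by omega)]
        gcongr; linarith
    · simp only [Icc.convexComb_zero]; rw [hρo i hi.le, h3.source]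
    · simp only [Icc.convexComb_one]; rw [hρo (i + 1) (by omega), h1.target]
  have hproj : ∀ x : ℝ, 0 ≤ x → x ≤ 1 → ((projIcc 0 1 zero_le_one x : I) : ℝ) = x :=
    fun x h0 h1 => by rw [projIcc_of_mem zero_le_one ⟨h0, h1⟩]
  obtain ⟨γ', hγ', hγρ⟩ := exists_isLocalGeodesic_of_overlap (M := M) (ρ := ρ)
    (fun i hi => (hρ i hi).1.isGeodesic) (fun i hi x h1 h2 => by
      have := hρhalf i hi ⟨x - (i + 1), by linarith, by linarith⟩
      convert this using 2 <;> ext <;> rw [hproj _ (by linarith) (by linarith)] <;>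
        simp only [Icc.coe_convexComb, ho, Icc.coe_one, Icc.coe_zero] <;> ring)
  have hcover : ∀ t : I, ∃ i ≤ M, (i : ℝ) ≤ (M + 2) * t ∧ (M + 2) * (t : ℝ) ≤ i + 2 := fun t => by
    have ht0 : 0 ≤ (M + 2) * (t : ℝ) := mul_nonneg hM0.le t.2.1
    rcases le_total ⌊(M + 2) * (t : ℝ)⌋₊ M with h | h
    · exact ⟨_, h, Nat.floor_le ht0, by linarith [Nat.lt_floor_add_one ((M + 2) * (t : ℝ))]⟩
    · exact ⟨M, le_rfl, (Nat.cast_le.2 h).trans (Nat.floor_le ht0), by nlinarith [t.2.2]⟩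
  refine ⟨γ', hγ', ?_, ?_, fun t => ?_⟩
  · rw [hγρ 0 (by omega) 0 (by simp) (by simp)]
    simp only [Icc.coe_zero, mul_zero, Nat.cast_zero, sub_zero, zero_div, projIcc_left]
    rw [show (⟨0, _⟩ : I) = 0 from rfl, (hρ 0 (by omega)).1.source, hw0, hτ0]
  · rw [hγρ M le_rfl 1 (by simp) (by simp)]
    have : (((M : ℝ) + 2) * ((1 : I) : ℝ) - M) / 2 = 1 := by rw [Icc.coe_one]; ring
    rw [this, projIcc_right]
    exact (hρ M le_rfl).1.target.trans hwN
  · obtain ⟨i, hi, h1, h2⟩ := hcover t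
    have := hρd i hi (projIcc 0 1 zero_le_one (((M + 2) * t - i) / 2))
    have e : Icc.convexComb (τ i) (τ (i + 2)) (projIcc 0 1 zero_le_one (((M + 2) * t - i) / 2)) =
        t := by
      ext
      rw [Icc.coe_convexComb, hproj _ (by linarith) (by linarith), hτ i (by omega),
        hτ (i + 2) (by omega)]
      push_cast; field_simp; ring
    rw [e] at this
    rw [hγρ i hi t h1 h2]; exact this

end Deformation

/-! ### The space of local geodesics issuing from a point -/

section Exponential

variable {X : Type u} [MetricSpace X]

/-- The local geodesics with origin `x₀`, as a subset of `C(I, X)`; it carries the uniform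
metric. -/
def localGeodesicsFrom (x₀ : X) : Set C(I, X) :=
  {γ | IsLocalGeodesic γ ∧ γ 0 = x₀}

/-- The exponential map, sending a local geodesic to its endpoint. -/
def geodesicExp (x₀ : X) (γ : localGeodesicsFrom x₀) : X :=
  γ.1 1

theorem continuous_geodesicExp (x₀ : X) : Continuous (geodesicExp x₀) :=
  (ContinuousEvalConst.continuous_eval_const (1 : I)).comp continuous_subtype_val

/-- The constant local geodesic. -/
def localGeodesicsFrom.const (x₀ : X) : localGeodesicsFrom x₀ :=
  ⟨ContinuousMap.const I x₀, (isGeodesic_const x₀).isLocalGeodesic, rfl⟩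

theorem IsLocallyConvexMetric.exists_ball_curve_subset (hX : IsLocallyConvexMetric X)
    (γ : C(I, X)) :
    ∃ ε > 0, ∀ t, ∃ U, IsConvexMetricOn U ∧ Metric.ball (γ t) ε ⊆ U := by
  obtain ⟨ε, hε, h⟩ := hX.exists_ball_subset (isCompact_range γ.continuous)
  exact ⟨ε, hε, fun t => h _ (mem_range_self t)⟩

theorem dist_apply_le_of_mem_ball {γ : C(I, X)} {ε : ℝ}
    (hU : ∀ t, ∃ U, IsConvexMetricOn U ∧ Metric.ball (γ t) ε ⊆ U) {γ₁ γ₂ : C(I, X)}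
    (h₁ : IsLocalGeodesic γ₁) (h₂ : IsLocalGeodesic γ₂) (h0 : γ₁ 0 = γ₂ 0)
    (d₁ : dist γ₁ γ < ε) (d₂ : dist γ₂ γ < ε) (t : I) :
    dist (γ₁ t) (γ₂ t) ≤ t * dist (γ₁ 1) (γ₂ 1) := by
  have := h₁.dist_le h₂ (fun t => by
    obtain ⟨U, hU, hb⟩ := hU t
    refine ⟨U, hU, ?_⟩
    have m (γ' : C(I, X)) (h : dist γ' γ < ε) : ∀ᶠ s in 𝓝 t, γ' s ∈ U :=
      (γ'.continuous.continuousAt.eventually (Metric.isOpen_ball.mem_nhds (Metric.mem_ball.2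
        ((ContinuousMap.dist_apply_le_dist t).trans_lt h)))).mono fun s hs => hb hs
    exact (m γ₁ d₁).and (m γ₂ d₂)) t
  simpa [h0] using this

/-- The exponential map is an isometry near each local geodesic, for the uniform metric. -/
theorem isLocalIsometry_geodesicExp [CompleteSpace X] (hX : IsLocallyConvexMetric X) (x₀ : X) :
    IsLocalIsometry (geodesicExp x₀) := by
  intro γ
  obtain ⟨ε, hε, hU⟩ := hX.exists_ball_curve_subset γ.1
  refine ⟨ε / 2, half_pos hε, fun γ₁ h₁ γ₂ h₂ => ?_, ?_⟩
  · refine le_antisymm (ContinuousMap.dist_apply_le_dist (f := γ₁.1) (g := γ₂.1) 1)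
      ((ContinuousMap.dist_le dist_nonneg).2 fun t => ?_)
    have h₁ : dist γ₁.1 γ.1 < ε / 2 := h₁
    have h₂ : dist γ₂.1 γ.1 < ε / 2 := h₂
    exact (dist_apply_le_of_mem_ball hU γ₁.2.1 γ₂.2.1 (γ₁.2.2.trans γ₂.2.2.symm)
      (by linarith) (by linarith) t).trans (mul_le_of_le_one_left dist_nonneg t.2.2)
  · refine Subset.antisymm ?_ fun y hy => ?_
    · rintro _ ⟨γ', h, rfl⟩
      exact (ContinuousMap.dist_apply_le_dist (f := γ'.1) (g := γ.1) 1).trans_lt h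
    · have hy : dist (γ.1 1) y < ε / 2 := Metric.mem_ball'.1 hy
      obtain ⟨γ', h', h0, h1, hd⟩ := γ.2.1.exists_near hε hU hy
      refine ⟨⟨⟨γ', h'.continuous⟩, h', h0.trans γ.2.2⟩, ?_, h1⟩
      rw [Metric.mem_ball']
      exact ((ContinuousMap.dist_le dist_nonneg).2 fun t => (hd t).trans
        (mul_le_of_le_one_left dist_nonneg t.2.2)).trans_lt hy

/-- In a convex set, a local geodesic is distance-realizing, with the speed it has at small
scales. -/
theorem IsLocalGeodesic.dist_eq_of_mem {γ : I → X} {c δ : ℝ} (hc : 0 ≤ c) (hδ : 0 < δ)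
    (h : ∀ s t : I, |(s : ℝ) - t| ≤ δ → dist (γ s) (γ t) = c * |(s : ℝ) - t|) {U : Set X}
    (hU : IsConvexMetricOn U) {a b : I} (hab : a ≤ b) (hγ : ∀ t ∈ Icc a b, γ t ∈ U) :
    dist (γ a) (γ b) = c * (b - a) := by
  have hab' : (0 : ℝ) ≤ b - a := sub_nonneg.2 hab
  have hg := (IsLocalGeodesic.comp_convexComb ⟨c, hc, δ, hδ, h⟩ hab).isGeodesic hU
    fun t => hγ _ ⟨Icc.le_convexComb hab t, Icc.convexComb_le hab t⟩
  obtain ⟨η, hη, hη1⟩ := exists_between (lt_min hδ one_pos)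
  rw [lt_min_iff] at hη1
  let e : I := ⟨η, hη.le, hη1.2.le⟩
  have h1 := hg.dist_eq 0 e
  have e0 : (Icc.convexComb a b e : ℝ) = a + η * (b - a) := by
    rw [Icc.coe_convexComb]; simp only [e]; ring
  have hb1 : (b : ℝ) - a ≤ 1 := by linarith [a.2.1, b.2.2]
  have e1 : |(a : ℝ) - Icc.convexComb a b e| = η * (b - a) := by
    rw [e0, abs_sub_comm, add_sub_cancel_left, abs_of_nonneg (mul_nonneg hη.le hab')]
  simp only [Icc.convexComb_zero, Icc.convexComb_one] at h1
  rw [h _ _ (by rw [e1]; nlinarith), e1] at h1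
  have e2 : |((0 : I) : ℝ) - e| = η := by simp [e, abs_of_pos hη]
  rw [e2] at h1
  have : η * (c * (b - a)) = η * dist (γ a) (γ b) := by linarith
  exact (mul_left_cancel₀ hη.ne' this).symm

/-- Uniform limits of local geodesics are local geodesics: near the limit, all local geodesics are
distance-realizing at one common scale. -/
theorem isClosed_localGeodesicsFrom (hX : IsLocallyConvexMetric X) (x₀ : X) :
    IsClosed (localGeodesicsFrom x₀) := by
  refine isClosed_of_closure_subset fun γ hγ => ?_
  obtain ⟨ε, hε, hU⟩ := hX.exists_ball_curve_subset γ
  obtain ⟨δ, hδ, hγδ⟩ := Metric.uniformContinuous_iff.1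
    (CompactSpace.uniformContinuous_of_continuous γ.continuous) (ε / 2) (half_pos hε)
  obtain ⟨η, hη, hη1⟩ := exists_between (lt_min hδ one_pos)
  rw [lt_min_iff] at hη1
  let e : I := ⟨η, hη.le, hη1.2.le⟩
  have he0 : (0 : I) ≤ e := unitInterval.nonneg'
  let S : Set C(I, X) := {γ' | γ' 0 = x₀ ∧ ∀ s t : I, s ≤ t → (t : ℝ) - s ≤ η →
    η * dist (γ' s) (γ' t) = (t - s) * dist (γ' 0) (γ' e)}
  have hS : IsClosed S := by
    have ev : ∀ t : I, Continuous fun γ' : C(I, X) => γ' t := fun t =>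
      ContinuousEvalConst.continuous_eval_const t
    simp only [S, ofPred_and, ofPred_forall]
    exact (isClosed_eq (ev 0) continuous_const).inter <|
      isClosed_iInter fun s => isClosed_iInter fun t => isClosed_iInter fun _ =>
        isClosed_iInter fun _ => isClosed_eq (continuous_const.mul ((ev s).dist (ev t)))
        (continuous_const.mul ((ev 0).dist (ev e)))
  have hsub : Metric.ball γ (ε / 2) ∩ localGeodesicsFrom x₀ ⊆ S := by
    rintro γ' ⟨hd, ⟨c, hc, δ', hδ', h⟩, h0⟩
    have key : ∀ s t : I, s ≤ t → (t : ℝ) - s ≤ η → dist (γ' s) (γ' t) = c * (t - s) := by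
      intro s t hst hle
      obtain ⟨U, hUc, hUb⟩ := hU s
      refine IsLocalGeodesic.dist_eq_of_mem hc hδ' h hUc hst fun r hr => hUb ?_
      have h1 : dist (γ' r) (γ r) < ε / 2 := (ContinuousMap.dist_apply_le_dist r).trans_lt hd
      have h2 : dist (γ r) (γ s) < ε / 2 := hγδ <| by
        have hr1 : (s : ℝ) ≤ r := hr.1
        have hr2 : (r : ℝ) ≤ t := hr.2
        rw [Subtype.dist_eq, Real.dist_eq, abs_of_nonneg (by linarith)]; linarith
      rw [Metric.mem_ball]
      linarith [dist_triangle (γ' r) (γ r) (γ s)]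
    refine ⟨h0, fun s t hst hle => ?_⟩
    rw [key s t hst hle, key 0 e he0 (by simp [e])]
    simp only [e, Icc.coe_zero]; ring
  have hγS : γ ∈ S := closure_minimal hsub hS
    (Metric.isOpen_ball.inter_closure ⟨Metric.mem_ball_self (half_pos hε), hγ⟩)
  refine ⟨⟨dist (γ 0) (γ e) / η, by positivity, η, hη, ?_⟩, hγS.1⟩
  have main : ∀ s t : I, s ≤ t → |(s : ℝ) - t| ≤ η →
      dist (γ s) (γ t) = dist (γ 0) (γ e) / η * |(s : ℝ) - t| := by
    intro s t hst hle
    have hst' : (s : ℝ) ≤ t := hst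
    rw [abs_sub_comm, abs_of_nonneg (by linarith)] at hle ⊢
    have := hγS.2 s t hst hle
    field_simp
    linarith
  intro s t hle
  rcases le_total s t with h | h
  · exact main s t h hle
  · rw [dist_comm, abs_sub_comm]; exact main t s h (by rwa [abs_sub_comm])

theorem completeSpace_localGeodesicsFrom [CompleteSpace X] (hX : IsLocallyConvexMetric X)
    (x₀ : X) : CompleteSpace (localGeodesicsFrom x₀) :=
  (isClosed_localGeodesicsFrom hX x₀).completeSpace_coe

/-- Local geodesics can be shrunk to their origin. -/
theorem contractibleSpace_localGeodesicsFrom (x₀ : X) :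
    ContractibleSpace (localGeodesicsFrom x₀) := by
  let F : I × localGeodesicsFrom x₀ → localGeodesicsFrom x₀ := fun p =>
    ⟨⟨fun t => p.2.1 (Icc.convexComb 0 (unitInterval.symm p.1) t),
      p.2.1.continuous.comp (Icc.continuous_convexComb _ _)⟩,
      p.2.2.1.comp_convexComb unitInterval.nonneg', by
        simpa only [ContinuousMap.coe_mk, Icc.convexComb_zero] using p.2.2.2⟩
  have hF : Continuous F := by
    refine Continuous.subtype_mk (ContinuousMap.continuous_of_continuous_uncurry _ ?_) _
    have h1 : Continuous fun q : (I × localGeodesicsFrom x₀) × I =>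
        Icc.convexComb (0 : I) (unitInterval.symm q.1.1) q.2 :=
      Icc.continuous_convexComb_prod.comp (continuous_const.prodMk
        ((unitInterval.continuous_symm.comp (continuous_fst.comp continuous_fst)).prodMk
          continuous_snd))
    have h2 : Continuous fun q : (I × localGeodesicsFrom x₀) × I => q.1.2.1 :=
      continuous_subtype_val.comp (continuous_snd.comp continuous_fst)
    exact h2.eval h1
  refine (contractible_iff_id_nullhomotopic _).2 ⟨localGeodesicsFrom.const x₀,
    ⟨⟨⟨F, hF⟩, fun γ => ?_, fun γ => ?_⟩⟩⟩
  · refine Subtype.ext (ContinuousMap.ext fun t => ?_)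
    simp [F]
  · refine Subtype.ext (ContinuousMap.ext fun t => ?_)
    simpa [F, localGeodesicsFrom.const] using γ.2.2

end Exponential

/-! ### Local isometries of complete spaces are coverings -/

section Covering

variable {X : Type u} [MetricSpace X] {E : Type v} [MetricSpace E]

theorem IsLocalIsometry.isLocalHomeomorph {f : E → X} (hf : IsLocalIsometry f) :
    IsLocalHomeomorph f := by
  refine isLocalHomeomorph_iff_isOpenEmbedding_restrict.2 fun e => ?_
  obtain ⟨r, hr, hiso, himg⟩ := hf e
  refine ⟨Metric.ball e r, Metric.ball_mem_nhds e hr, ?_, ?_⟩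
  · exact (Isometry.of_dist_eq (f := (Metric.ball e r).domRestrict f)
      fun a b => hiso _ a.2 _ b.2).isEmbedding
  · rw [range_domRestrict, himg]; exact Metric.isOpen_ball

/-- Lipschitz paths lift through a local isometry with complete domain. -/
theorem IsLocalIsometry.exists_lift [CompleteSpace E] {f : E → X} (hf : IsLocalIsometry f)
    {K : NNReal} {p : I → X} (hp : LipschitzWith K p) {e : E} (he : f e = p 0) :
    ∃ g : I → E, LipschitzWith K g ∧ g 0 = e ∧ ∀ t, f (g t) = p t := by
  have hloc := hf.isLocalHomeomorph
  -- times up to which a lift exists; lifts are frozen afterwards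
  let S : Set I := {s | ∃ g : I → E, LipschitzWith K g ∧ g 0 = e ∧ ∀ t, f (g t) = p (min t s)}
  have hunique : ∀ s s' : I, s ≤ s' → ∀ g g' : I → E, LipschitzWith K g → LipschitzWith K g' →
      g 0 = e → g' 0 = e → (∀ t, f (g t) = p (min t s)) → (∀ t, f (g' t) = p (min t s')) →
      ∀ t, g t = g' (min t s) := by
    intro s s' hs g g' hg hg' h0 h0' hfg hfg' t
    refine congrFun ((T2Space.isSeparatedMap f).eq_of_comp_eq hloc.isLocallyInjective
      (g₂ := fun t => g' (min t s)) hg.continuous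
      (hg'.continuous.comp (continuous_id.min continuous_const)) (funext fun t => ?_) 0 ?_) t
    · simp only [Function.comp_apply, hfg, hfg', min_assoc, min_eq_left hs]
    · rw [min_eq_left unitInterval.nonneg', h0, h0']
  have hmin : ∀ t s s' : I, dist (min t s) (min t s') ≤ dist s s' := fun t s s' => by
    rw [Subtype.dist_eq, Subtype.dist_eq, Real.dist_eq, Real.dist_eq]
    have := abs_min_sub_min_le_max (t : ℝ) s t s'
    simpa using this
  have hclosed : IsClosed S := by
    refine isClosed_of_closure_subset fun s hs => ?_
    obtain ⟨sq, hsq, hlim⟩ := mem_closure_iff_seq_limit.1 hs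
    choose g hg hg0 hgf using hsq
    have hdist : ∀ n m t, dist (g n t) (g m t) ≤ K * dist (sq n) (sq m) := by
      have main : ∀ n m t, sq n ≤ sq m → dist (g n t) (g m t) ≤ K * dist (sq n) (sq m) := by
        intro n m t h
        have hmt : g m t = g m (min t (sq m)) :=
          hunique _ _ le_rfl _ _ (hg m) (hg m) (hg0 m) (hg0 m) (hgf m) (hgf m) t
        rw [hunique _ _ h _ _ (hg n) (hg m) (hg0 n) (hg0 m) (hgf n) (hgf m) t, hmt]
        exact ((hg m).dist_le_mul _ _).trans (by gcongr; exact hmin _ _ _)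
      intro n m t
      rcases le_total (sq n) (sq m) with h | h
      · exact main n m t h
      · rw [dist_comm, dist_comm (sq n)]; exact main m n t h
    have hcau : ∀ t, CauchySeq fun n => g n t := fun t => by
      have h1 := hlim.cauchySeq
      rw [Metric.cauchySeq_iff'] at h1 ⊢
      intro ε hε
      obtain ⟨N, hN⟩ := h1 (ε / (K + 1)) (by positivity)
      refine ⟨N, fun n hn => (hdist n N t).trans_lt ?_⟩
      have := hN n hn
      rw [lt_div_iff₀ (by positivity)] at this
      nlinarith [dist_nonneg (x := sq n) (y := sq N)]
    choose G hG using fun t => cauchySeq_tendsto_of_complete (hcau t)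
    refine ⟨G, LipschitzWith.of_dist_le_mul fun a b => ?_, ?_, fun t => ?_⟩
    · exact le_of_tendsto ((hG a).dist (hG b))
        (Filter.Eventually.of_forall fun n => (hg n).dist_le_mul a b)
    · exact tendsto_nhds_unique (hG 0) (by simpa only [hg0] using tendsto_const_nhds)
    · refine tendsto_nhds_unique ((hloc.continuous.tendsto _).comp (hG t)) ?_
      have h1 : Filter.Tendsto (fun n => p (min t (sq n))) Filter.atTop (𝓝 (p (min t s))) :=
        (hp.continuous.tendsto _).comp (tendsto_const_nhds.min hlim)
      simpa only [Function.comp_def, hgf] using h1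
  have h0S : (0 : I) ∈ S := ⟨fun _ => e, LipschitzWith.const' e, rfl, fun t => by
    rw [min_eq_right unitInterval.nonneg', he]⟩
  have hext : ∀ s ∈ S ∩ Ico 0 1, ∀ y ∈ Ioi s, (S ∩ Ioc s y).Nonempty := by
    rintro s ⟨⟨g, hg, hg0, hgf⟩, -⟩ y hy
    have hsy : (s : ℝ) < y := hy
    obtain ⟨r, hr, hiso, himg⟩ := hf (g s)
    obtain ⟨η, hη, hη1⟩ := exists_between (show (0 : ℝ) < min ((y : ℝ) - s) (r / (K + 1)) from
      lt_min (by linarith) (by positivity))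
    rw [lt_min_iff, lt_div_iff₀ (by positivity)] at hη1
    let s' : I := ⟨s + η, by linarith [s.2.1], by linarith [y.2.2]⟩
    have hss' : s < s' := by change (s : ℝ) < s + η; linarith
    have hfs : f (g s) = p s := by rw [hgf, min_self]
    have hφ : ∀ t, s ≤ t → ∃ x ∈ Metric.ball (g s) r, f x = p (min t s') := fun t ht => by
      have : p (min t s') ∈ Metric.ball (f (g s)) r := by
        rw [hfs, Metric.mem_ball]
        refine (hp.dist_le_mul _ _).trans_lt ?_
        have h1 : s ≤ min t s' := le_min ht hss'.le
        have h2 : ((min t s' : I) : ℝ) ≤ s + η := min_le_right t s'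
        have h1' : (s : ℝ) ≤ (min t s' : I) := h1
        rw [Subtype.dist_eq, Real.dist_eq, abs_of_nonneg (by linarith)]
        have : (K : ℝ) * ((min t s' : I) - s) ≤ K * η := by gcongr; linarith
        nlinarith
      rwa [← himg] at this
    have : Nonempty E := ⟨e⟩
    choose! φ hφb hφf using hφ
    let g' : I → E := fun t => if t ≤ s then g t else φ t
    have hg'f : ∀ t, f (g' t) = p (min t s') := fun t => by
      by_cases h : t ≤ s
      · simp only [g', if_pos h, hgf, min_eq_left h, min_eq_left (h.trans hss'.le)]
      · simp only [g', if_neg h, hφf t (not_le.1 h).le]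
    have hlip : ∀ t t' : I, t ≤ t' → dist (g' t) (g' t') ≤ K * dist t t' := by
      intro t t' htt'
      by_cases h' : t' ≤ s
      · simp only [g', if_pos h', if_pos (htt'.trans h')]; exact hg.dist_le_mul _ _
      have hst' := (not_le.1 h').le
      by_cases h : t ≤ s
      · simp only [g', if_pos h, if_neg h']
        have h1 : dist (g s) (φ t') ≤ K * dist s t' := by
          rw [← hiso _ (Metric.mem_ball_self hr) _ (hφb t' hst'), hφf t' hst', hfs]
          refine (hp.dist_le_mul _ _).trans (mul_le_mul_of_nonneg_left ?_ K.2)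
          have h2 : (s : ℝ) ≤ (min t' s' : I) := le_min hst' hss'.le
          have h3 : ((min t' s' : I) : ℝ) ≤ t' := min_le_left t' s'
          have h4 : (s : ℝ) ≤ t' := hst'
          rw [dist_comm, dist_comm s, Subtype.dist_eq, Subtype.dist_eq, Real.dist_eq, Real.dist_eq,
            abs_of_nonneg (sub_nonneg.2 h2), abs_of_nonneg (sub_nonneg.2 h4)]
          exact sub_le_sub_right h3 _
        have h2 : dist t t' = dist t s + dist s t' := by
          rw [dist_comm t t', dist_comm t s, dist_comm s t']
          simp only [Subtype.dist_eq, Real.dist_eq]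
          have e1 : (t : ℝ) ≤ t' := htt'
          have e2 : (t : ℝ) ≤ s := h
          have e3 : (s : ℝ) ≤ t' := hst'
          rw [abs_of_nonneg (sub_nonneg.2 e1), abs_of_nonneg (sub_nonneg.2 e2),
            abs_of_nonneg (sub_nonneg.2 e3)]
          ring
        rw [h2, mul_add]
        exact (dist_triangle _ (g s) _).trans (add_le_add (hg.dist_le_mul _ _) h1)
      · have hst := (not_le.1 h).le
        simp only [g', if_neg h, if_neg h']
        rw [← hiso _ (hφb t hst) _ (hφb t' hst'), hφf t hst, hφf t' hst']
        refine (hp.dist_le_mul _ _).trans (mul_le_mul_of_nonneg_left ?_ K.2)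
        rw [min_comm t, min_comm t']
        exact hmin _ _ _
    refine ⟨s', ⟨g', LipschitzWith.of_dist_le_mul fun t t' => ?_, ?_, hg'f⟩, hss', ?_⟩
    · rcases le_total t t' with h | h
      · exact hlip t t' h
      · rw [dist_comm, dist_comm t]; exact hlip t' t h
    · simp only [g', if_pos (unitInterval.nonneg' : 0 ≤ s), hg0]
    · change (s : ℝ) + η ≤ y; linarith
  obtain ⟨g, hg, hg0, hgf⟩ := IsClosed.Icc_subset_of_forall_exists_gt
    (hclosed.inter isClosed_Icc) h0S hext (right_mem_Icc.2 (unitInterval.nonneg' : (0 : I) ≤ 1))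
  exact ⟨g, hg, hg0, fun t => by rw [hgf, min_eq_left unitInterval.le_one']⟩

theorem IsGeodesic.lipschitzWith {γ : I → X} (h : IsGeodesic γ) :
    LipschitzWith (nndist (γ 0) (γ 1)) γ :=
  LipschitzWith.of_dist_le_mul fun s t => by
    rw [h.dist_eq, coe_nndist, Subtype.dist_eq, Real.dist_eq]

theorem IsGeodesicallyConvex.isPreconnected {U : Set X} (hU : IsGeodesicallyConvex U) :
    IsPreconnected U :=
  isPreconnected_of_forall_pair fun x hx y hy => by
    obtain ⟨γ, hγ, hγU⟩ := hU x hx y hy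
    exact ⟨range γ, range_subset_iff.2 hγU, ⟨0, hγ.source⟩, ⟨1, hγ.target⟩,
      isPreconnected_range hγ.isGeodesic.lipschitzWith.continuous⟩

/-- Balls inside a convex set are convex. -/
theorem IsConvexMetricOn.ball {U : Set X} (hU : IsConvexMetricOn U) {x : X} {r : ℝ}
    (h : Metric.ball x r ⊆ U) : IsConvexMetricOn (Metric.ball x r) := by
  refine ⟨fun y hy z hz => ?_, fun γ₁ γ₂ h₁ h₂ m₁ m₂ =>
    hU.2 γ₁ γ₂ h₁ h₂ (fun t => h (m₁ t)) fun t => h (m₂ t)⟩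
  obtain ⟨γ, hγ, hγU⟩ := hU.1 y (h hy) z (h hz)
  refine ⟨γ, hγ, fun t => ?_⟩
  have hr : 0 < r := Metric.pos_of_mem_ball hy
  have := hU.2 γ (fun _ => x) hγ.isGeodesic (isGeodesic_const x) hγU
    (fun _ => h (Metric.mem_ball_self hr)) t
  rw [hγ.source, hγ.target] at this
  rw [Metric.mem_ball] at hy hz ⊢
  refine this.trans_lt ?_
  rcases (t.2.1 : (0 : ℝ) ≤ t).eq_or_lt with h0 | h0
  · rw [← h0]; simpa using hy
  · have : (t : ℝ) ≤ 1 := t.2.2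
    nlinarith

theorem IsLocallyConvexMetric.exists_ball (hX : IsLocallyConvexMetric X) (x : X) :
    ∃ r > 0, ∀ r' ≤ r, IsConvexMetricOn (Metric.ball x r') := by
  obtain ⟨U, hU, hUc⟩ := hX x
  obtain ⟨r, hr, hrU⟩ := Metric.mem_nhds_iff.1 hU
  exact ⟨r, hr, fun r' h => hUc.ball ((Metric.ball_subset_ball h).trans hrU)⟩

/-- Over a convex set, a local isometry with complete domain has continuous sections: geodesics
from a base point are lifted, and the lifts depend continuously on the endpoint. -/
theorem IsLocalIsometry.exists_section [CompleteSpace E] {f : E → X} (hf : IsLocalIsometry f)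
    {V : Set X} (hV : IsConvexMetricOn V) {e : E} (he : f e ∈ V) :
    ∃ τ : V → E, Continuous τ ∧ (∀ z, f (τ z) = z) ∧ τ ⟨f e, he⟩ = e := by
  have hloc := hf.isLocalHomeomorph
  choose g hg hgV using fun z : V => hV.1 (f e) he z z.2
  have hlift : ∀ z : V, ∃ G : I → E, Continuous G ∧ G 0 = e ∧ ∀ t, f (G t) = g z t := fun z => by
    obtain ⟨G, hG, hG0, hGf⟩ := hf.exists_lift (hg z).isGeodesic.lipschitzWith (e := e)
      (hg z).source.symm
    exact ⟨G, hG.continuous, hG0, hGf⟩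
  choose G hG hG0 hGf using hlift
  have hcont : Continuous fun q : I × V => g q.2 q.1 := by
    refine continuous_prod_of_continuous_lipschitzWith' _ 1 (fun t => ?_) fun z =>
      (hg z).isGeodesic.lipschitzWith.continuous
    refine LipschitzWith.of_dist_le_mul fun z z' => ?_
    have := hV.2 _ _ (hg z).isGeodesic (hg z').isGeodesic (hgV z) (hgV z') t
    rw [(hg z).source, (hg z').source, (hg z).target, (hg z').target, dist_self, mul_zero,
      zero_add] at this
    rw [NNReal.coe_one, one_mul]
    exact this.trans (mul_le_of_le_one_left dist_nonneg t.2.2)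
  have hGc : Continuous fun q : I × V => G q.2 q.1 :=
    hloc.continuous_lift (T2Space.isSeparatedMap f) ⟨_, hcont⟩ (funext fun q => hGf q.2 q.1)
      (by simpa only [hG0] using continuous_const) hG
  refine ⟨fun z => G z 1, hGc.comp (continuous_const.prodMk continuous_id),
    fun z => by rw [hGf, (hg z).target], ?_⟩
  have hconst : g ⟨f e, he⟩ = fun _ => f e :=
    hV.eq_of_endpoints (hg _).isGeodesic (isGeodesic_const _) (hgV _) (fun _ => he)
      (hg _).source (hg _).target
  exact ((T2Space.isSeparatedMap f).const_of_comp hloc.isLocallyInjective (hG ⟨f e, he⟩)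
    (fun a a' => by rw [hGf, hGf, hconst]) 1 0).trans (hG0 _)

/-- The sheets over a small ball are the images of the sections through the points of the fibre over
its center. -/
theorem IsLocalIsometry.isCoveringMap [CompleteSpace E] {f : E → X} (hf : IsLocalIsometry f)
    (hX : IsLocallyConvexMetric X) : IsCoveringMap f := by
  have hloc := hf.isLocalHomeomorph
  intro x
  obtain ⟨r, hr, hball⟩ := hX.exists_ball x
  set V := Metric.ball x r with hVdef
  have hV : IsConvexMetricOn V := hball r le_rfl
  have hxV : x ∈ V := Metric.mem_ball_self hr
  have hVo : IsOpen V := Metric.isOpen_ball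
  have : PreconnectedSpace V := isPreconnected_iff_preconnectedSpace.1 hV.1.isPreconnected
  have huniq : ∀ τ τ' : V → E, Continuous τ → Continuous τ' → (∀ z, f (τ z) = z) →
      (∀ z, f (τ' z) = z) → ∀ z, τ z = τ' z → τ = τ' := fun τ τ' h h' hf hf' z hz =>
    (T2Space.isSeparatedMap f).eq_of_comp_eq hloc.isLocallyInjective h h'
      (funext fun z => (hf z).trans (hf' z).symm) z hz
  choose s hsc hsf hsx using fun i : f ⁻¹' {x} =>
    hf.exists_section hV (e := i.1) (by rw [show f i.1 = x from i.2]; exact hxV)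
  have hsx' : ∀ i, s i ⟨x, hxV⟩ = i := fun i => by
    rw [← hsx i]; congr 2; exact (show f i.1 = x from i.2).symm
  have hexh : f ⁻¹' V ⊆ ⋃ i, range (s i) := fun e he => by
    obtain ⟨τ, hτ, hτf, hτe⟩ := hf.exists_section hV he
    let i : f ⁻¹' {x} := ⟨τ ⟨x, hxV⟩, hτf _⟩
    refine mem_iUnion.2 ⟨i, ⟨f e, he⟩, ?_⟩
    rw [huniq (s i) τ (hsc i) hτ (hsf i) hτf ⟨x, hxV⟩ (hsx' i), hτe]
  rcases isEmpty_or_nonempty (f ⁻¹' {x}) with hemp | hne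
  · refine IsEvenlyCovered.of_preimage_eq_empty _ (hVo.mem_nhds hxV) ?_
    simpa using hexh
  let _ : TopologicalSpace (f ⁻¹' {x}) := ⊥
  have : DiscreteTopology (f ⁻¹' {x}) := ⟨rfl⟩
  have : Nonempty (X → E) := ⟨fun _ => hne.some.1⟩
  have hopen : ∀ i, IsOpen (range (s i)) := fun i =>
    (hloc.isOpenEmbedding_of_comp (f := s i)
      (by rw [show f ∘ s i = Subtype.val from funext (hsf i)]; exact hVo.isOpenEmbedding_subtypeVal)
      (hsc i)).isOpen_range
  have hcov : IsEvenlyCovered f x (f ⁻¹' {x}) := IsEvenlyCovered.of_trivialization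
    (t := IsOpen.trivializationDiscrete (fun i => range (s i)) V hVo
      (fun i W hW => ⟨fun h => (h.preimage hloc.continuous).inter (hopen i), fun h => ?_⟩)
      (fun i => ?_) (fun i z hz => ⟨s i ⟨z, hz⟩, mem_range_self _, hsf i ⟨z, hz⟩⟩)
      (fun i j hij => ?_) hexh) hxV
  · exact hcov.to_isEvenlyCovered_preimage
  · convert hloc.isOpenMap _ h
    ext z
    constructor
    · intro hz
      refine ⟨s i ⟨z, hW hz⟩, ⟨?_, mem_range_self _⟩, hsf i ⟨z, hW hz⟩⟩
      change f (s i ⟨z, hW hz⟩) ∈ W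
      rw [hsf]; exact hz
    · rintro ⟨e, ⟨he, -⟩, rfl⟩; exact he
  · rintro _ ⟨z, rfl⟩ _ ⟨z', rfl⟩ h
    rw [hsf, hsf] at h
    rw [Subtype.ext h]
  · refine Set.disjoint_left.2 ?_
    rintro _ ⟨z, rfl⟩ ⟨z', h⟩
    have hz : z' = z := Subtype.ext (by rw [← hsf j z', h, hsf])
    subst hz
    refine hij (Subtype.ext ?_)
    rw [← hsx' i, ← hsx' j, huniq _ _ (hsc j) (hsc i) (hsf j) (hsf i) _ h]

/-- The exponential map is a universal cover. -/
theorem exists_universalCover [CompleteSpace X] [Nonempty X] (hX : IsLocallyConvexMetric X) :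
    ∃ (E : Type u) (_ : TopologicalSpace E) (p : E → X), IsUniversalCover p := by
  let x₀ : X := Classical.arbitrary X
  have := completeSpace_localGeodesicsFrom hX x₀
  have := contractibleSpace_localGeodesicsFrom x₀
  exact ⟨localGeodesicsFrom x₀, inferInstance, geodesicExp x₀,
    (isLocalIsometry_geodesicExp hX x₀).isCoveringMap hX, inferInstance⟩

end Covering

/-! ### The lifted length metric -/

section LiftedMetric

theorem Path.eVariationOn_symm_le {E F : Type*} [TopologicalSpace E] [PseudoEMetricSpace F]
    (f : E → F) {x y : E} (γ : Path x y) :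
    eVariationOn (f ∘ γ.symm) univ ≤ eVariationOn (f ∘ γ) univ :=
  eVariationOn.comp_le_of_antitoneOn (f ∘ γ) unitInterval.symm
    (unitInterval.strictAnti_symm.antitone.antitoneOn _) (mapsTo_univ _ _)

theorem Path.eVariationOn_trans_le {E F : Type*} [TopologicalSpace E] [PseudoEMetricSpace F]
    (f : E → F) {x y z : E} (γ : Path x y) (γ' : Path y z) :
    eVariationOn (f ∘ γ.trans γ') univ ≤
      eVariationOn (f ∘ γ) univ + eVariationOn (f ∘ γ') univ := by
  let o : I := ⟨1 / 2, by norm_num, by norm_num⟩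
  have ho : (o : ℝ) = 1 / 2 := rfl
  have h1 : eVariationOn (f ∘ γ.trans γ') (Icc 0 o) ≤ eVariationOn (f ∘ γ) univ := by
    have : EqOn (f ∘ γ.trans γ')
        ((f ∘ γ) ∘ fun t : I => projIcc 0 1 zero_le_one (2 * (t : ℝ))) (Icc 0 o) := by
      rintro t ⟨-, ht⟩
      have ht : (t : ℝ) ≤ 1 / 2 := ht
      simp only [Function.comp_apply, Path.trans_apply, dif_pos ht]
      rw [projIcc_of_mem]
    rw [eVariationOn.congr this]
    refine eVariationOn.comp_le_of_monotoneOn _ _ (fun s _ t _ hst => ?_) (mapsTo_univ _ _)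
    have hst : (s : ℝ) ≤ t := hst
    exact monotone_projIcc _ (by linarith)
  have h2 : eVariationOn (f ∘ γ.trans γ') (Icc o 1) ≤ eVariationOn (f ∘ γ') univ := by
    have : EqOn (f ∘ γ.trans γ')
        ((f ∘ γ') ∘ fun t : I => projIcc 0 1 zero_le_one (2 * (t : ℝ) - 1)) (Icc o 1) := by
      rintro t ⟨ht, -⟩
      have ht : 1 / 2 ≤ (t : ℝ) := ht
      simp only [Function.comp_apply, Path.trans_apply]
      split_ifs with h
      · have e : (t : ℝ) = 1 / 2 := le_antisymm h ht
        have e1 : (⟨2 * t, (unitInterval.mul_pos_mem_iff zero_lt_two).2 ⟨t.2.1, h⟩⟩ : I) = 1 :=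
          Subtype.ext (by simp [e])
        have e2 : (projIcc 0 1 zero_le_one (2 * (t : ℝ) - 1) : I) = 0 := by
          rw [e]; norm_num
        rw [e1, e2, γ.target, γ'.source]
      · rw [projIcc_of_mem]
    rw [eVariationOn.congr this]
    refine eVariationOn.comp_le_of_monotoneOn _ _ (fun s _ t _ hst => ?_) (mapsTo_univ _ _)
    have hst : (s : ℝ) ≤ t := hst
    exact monotone_projIcc _ (by linarith)
  have h3 := eVariationOn.Icc_add_Icc (f ∘ γ.trans γ') (s := univ)
    (show (0 : I) ≤ o from unitInterval.nonneg') (show o ≤ 1 from unitInterval.le_one') (mem_univ _)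
  simp only [univ_inter] at h3
  rw [unitInterval.univ_eq_Icc, ← h3, ← unitInterval.univ_eq_Icc]
  exact add_le_add h1 h2

variable {X : Type u} [MetricSpace X]

/-- In a length space, points at distance less than `c` are joined by a curve of length less than
`c`. -/
theorem IsLengthSpace.exists_path (hX : IsLengthSpace X) {x y : X} {c : ENNReal}
    (h : edist x y < c) : ∃ γ : Path x y, eVariationOn (γ : I → X) univ < c := by
  rw [hX x y] at h
  exact iInf_lt_iff.1 h

/-- A curve stays within its length of its origin. -/
theorem edist_source_le {F : Type*} [PseudoEMetricSpace F] (γ : I → F) (t : I) :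
    edist (γ t) (γ 0) ≤ eVariationOn γ univ :=
  eVariationOn.edist_le γ (mem_univ _) (mem_univ _)

theorem IsLengthSpace.locallyPathConnectedSpace (hX : IsLengthSpace X) :
    LocallyPathConnectedSpace X := by
  refine LocallyPathConnectedSpace.of_bases (fun x => Metric.nhds_basis_eball (x := x))
    fun x r hr => ⟨x, Metric.mem_eball_self hr, fun {y} hy => ?_⟩
  obtain ⟨γ, hγ⟩ := hX.exists_path (c := r) (x := x) (y := y) (by rw [edist_comm]; exact hy)
  refine ⟨γ, fun t => (Metric.mem_eball).2 ?_⟩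
  have := edist_source_le γ t
  rw [γ.source] at this
  exact this.trans_lt hγ

variable {E : Type v}

/-- The infimum of the lengths of the projections to `X` of the paths joining two points of
`E`. -/
noncomputable def liftedEDist [TopologicalSpace E] (p : E → X) (x y : E) : ENNReal :=
  ⨅ γ : Path x y, eVariationOn (p ∘ γ) univ

section Topological

variable [TopologicalSpace E] {p : E → X}

theorem edist_le_liftedEDist (x y : E) : edist (p x) (p y) ≤ liftedEDist p x y :=
  le_iInf fun γ => by
    have := edist_source_le (p ∘ γ) 1
    simp only [Function.comp_apply, γ.source, γ.target] at this
    rwa [edist_comm]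

theorem liftedEDist_self (x : E) : liftedEDist p x x = 0 := by
  refine le_antisymm (iInf_le_of_le (Path.refl x) ?_) zero_le
  exact (eVariationOn.constant_on (by rintro _ ⟨s, -, rfl⟩ _ ⟨t, -, rfl⟩; simp)).le

theorem liftedEDist_comm (x y : E) : liftedEDist p x y = liftedEDist p y x :=
  le_antisymm
    (le_iInf fun γ => iInf_le_of_le γ.symm (γ.eVariationOn_symm_le p))
    (le_iInf fun γ => iInf_le_of_le γ.symm (γ.eVariationOn_symm_le p))

theorem liftedEDist_triangle (x y z : E) :
    liftedEDist p x z ≤ liftedEDist p x y + liftedEDist p y z := by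
  unfold liftedEDist
  rw [ENNReal.iInf_add]
  refine le_iInf fun γ => ?_
  rw [ENNReal.add_iInf]
  exact le_iInf fun γ' => iInf_le_of_le (γ.trans γ') (γ.eVariationOn_trans_le p γ')

/-- Around each point of a covering of a length space there is a sheet over a ball on which the
lifted distance is the distance of the projections, and which contains the balls of the lifted
distance. -/
theorem IsCoveringMap.exists_sheet (hp : IsCoveringMap p) (hX : IsLengthSpace X) (e : E) :
    ∃ φ : OpenPartialHomeomorph E X, φ = p ∧ e ∈ φ.source ∧ ∃ R > 0,
      Metric.ball (p e) R ⊆ φ.target ∧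
      (∀ x ∈ φ.source, ∀ y ∈ φ.source, p x ∈ Metric.ball (p e) R → p y ∈ Metric.ball (p e) R →
        liftedEDist p x y = edist (p x) (p y)) ∧
      ∀ y, liftedEDist p e y < ENNReal.ofReal R → y ∈ φ.source := by
  obtain ⟨φ, heφ, hφ⟩ := hp.isLocalHomeomorph e
  have hφ' : ∀ x, φ x = p x := fun x => by rw [hφ]
  obtain ⟨R, hR, hball⟩ := Metric.mem_nhds_iff.1 (φ.open_target.mem_nhds (φ.map_source heφ))
  rw [hφ'] at hball
  refine ⟨φ, hφ.symm, heφ, R / 3, by positivity,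
    (Metric.ball_subset_ball (by linarith)).trans hball, fun x hx y hy hxR hyR => ?_,
    fun y hy => ?_⟩
  · refine le_antisymm (le_of_forall_gt fun c hc => ?_) (edist_le_liftedEDist x y)
    have hlt : edist (p x) (p y) < min c (ENNReal.ofReal (2 * R / 3)) := by
      refine lt_min hc ?_
      rw [edist_dist, ENNReal.ofReal_lt_ofReal_iff (by positivity)]
      have h1 := Metric.mem_ball.1 hxR
      have h2 := Metric.mem_ball.1 hyR
      linarith [dist_triangle_right (p x) (p y) (p e)]
    obtain ⟨γ, hγ⟩ := hX.exists_path hlt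
    have hγt : ∀ t, γ t ∈ φ.target := fun t => hball <| by
      have h1 := (edist_source_le γ t).trans_lt (hγ.trans_le (min_le_right _ _))
      rw [γ.source, edist_dist, ENNReal.ofReal_lt_ofReal_iff (by positivity)] at h1
      have h2 := Metric.mem_ball.1 hxR
      rw [Metric.mem_ball]
      linarith [dist_triangle (γ t) (p x) (p e)]
    have hs : φ.symm (p x) = x := by rw [← hφ', φ.left_inv hx]
    have ht : φ.symm (p y) = y := by rw [← hφ', φ.left_inv hy]
    let γ' : Path x y :=
      { toFun := fun t => φ.symm (γ t)
        continuous_toFun := φ.continuousOn_symm.comp_continuous γ.continuous hγt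
        source' := by rw [γ.source, hs]
        target' := by rw [γ.target, ht] }
    have hpγ : p ∘ γ' = γ := funext fun t => by
      change p (φ.symm (γ t)) = γ t
      rw [← hφ', φ.right_inv (hγt t)]
    refine (iInf_le _ γ').trans_lt ?_
    rw [hpγ]
    exact hγ.trans_le (min_le_left _ _)
  · obtain ⟨γ, hγ⟩ := iInf_lt_iff.1 hy
    have hγt : ∀ t, p (γ t) ∈ φ.target := fun t => hball <| by
      have h1 := (edist_source_le (p ∘ γ) t).trans_lt hγ
      simp only [Function.comp_apply] at h1
      rw [γ.source, edist_dist, ENNReal.ofReal_lt_ofReal_iff (by positivity)] at h1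
      rw [Metric.mem_ball]
      linarith
    have heq : (γ : I → E) = fun t => φ.symm (p (γ t)) := by
      refine hp.eq_of_comp_eq γ.continuous
        (φ.continuousOn_symm.comp_continuous (hp.continuous.comp γ.continuous) hγt)
        (funext fun t => ?_) 0 ?_
      · simp only [Function.comp_apply]
        rw [← hφ' (φ.symm _), φ.right_inv (hγt t)]
      · rw [γ.source, ← hφ', φ.left_inv heφ]
    have := congrFun heq 1
    rw [γ.target] at this
    rw [this]
    have h1 := hγt 1
    rw [γ.target] at h1
    exact φ.map_target h1

/-- The points at finite lifted distance from a given one form an open and closed set. -/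
theorem IsCoveringMap.liftedEDist_ne_top [PreconnectedSpace E] (hp : IsCoveringMap p)
    (hX : IsLengthSpace X) (x y : E) : liftedEDist p x y ≠ ⊤ := by
  have hnear : ∀ e : E, ∃ W ∈ 𝓝 e, ∀ z ∈ W, liftedEDist p e z ≠ ⊤ := fun e => by
    obtain ⟨φ, hφ, heφ, R, hR, -, hd, -⟩ := hp.exists_sheet hX e
    refine ⟨φ.source ∩ p ⁻¹' Metric.ball (p e) R, Filter.inter_mem (φ.open_source.mem_nhds heφ)
      (hp.continuous.continuousAt.preimage_mem_nhds (Metric.ball_mem_nhds _ hR)), ?_⟩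
    rintro z ⟨hz, hzR⟩
    rw [hd e heφ z hz (Metric.mem_ball_self hR) hzR]
    exact edist_ne_top _ _
  have hclopen : IsClopen {z | liftedEDist p x z ≠ ⊤} := by
    refine ⟨⟨isOpen_iff_mem_nhds.2 fun z hz => ?_⟩, isOpen_iff_mem_nhds.2 fun z hz => ?_⟩
    · obtain ⟨W, hW, h⟩ := hnear z
      refine Filter.mem_of_superset hW fun w hw hfin => hz ?_
      refine ne_top_of_le_ne_top (ENNReal.add_ne_top.2 ⟨hfin, ?_⟩) (liftedEDist_triangle x w z)
      rw [liftedEDist_comm]; exact h w hw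
    · obtain ⟨W, hW, h⟩ := hnear z
      refine Filter.mem_of_superset hW fun w hw => ?_
      exact ne_top_of_le_ne_top (ENNReal.add_ne_top.2 ⟨hz, h w hw⟩) (liftedEDist_triangle x z w)
  have : y ∈ {z | liftedEDist p x z ≠ ⊤} := by
    rw [hclopen.eq_univ ⟨x, by simp [liftedEDist_self]⟩]; trivial
  exact this

/-- The lifted distance is a metric inducing the topology of the covering space. -/
theorem IsCoveringMap.exists_metricSpace [PreconnectedSpace E] (hp : IsCoveringMap p)
    (hX : IsLengthSpace X) :
    ∃ m : MetricSpace E, m.toPseudoMetricSpace.toUniformSpace.toTopologicalSpace = ‹_› ∧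
      ∀ x y, m.edist x y = liftedEDist p x y := by
  let em : EMetricSpace E :=
    { edist := liftedEDist p
      edist_self := liftedEDist_self
      edist_comm := liftedEDist_comm
      edist_triangle := liftedEDist_triangle
      eq_of_edist_eq_zero := fun {x y} h => by
        obtain ⟨φ, hφ, hxφ, R, hR, -, -, hs⟩ := hp.exists_sheet hX x
        have hy : y ∈ φ.source := hs y (by rw [h]; exact ENNReal.ofReal_pos.2 hR)
        refine φ.injOn hxφ hy ?_
        rw [hφ]
        exact edist_le_zero.1 ((edist_le_liftedEDist x y).trans h.le) }
  refine ⟨EMetricSpace.toMetricSpace (hp.liftedEDist_ne_top hX), ?_, fun _ _ => rfl⟩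
  refine TopologicalSpace.ext_nhds fun e => ?_
  have hb := @Metric.nhds_basis_eball E em.toPseudoEMetricSpace e
  refine (hb.ext (𝓝 e).basis_sets (fun r hr => ?_) fun N hN => ?_ :)
  · obtain ⟨φ, hφ, heφ, R, hR, -, hd, -⟩ := hp.exists_sheet hX e
    refine ⟨φ.source ∩ p ⁻¹' (Metric.ball (p e) R ∩ Metric.eball (p e) r),
      Filter.inter_mem (φ.open_source.mem_nhds heφ)
        (hp.continuous.continuousAt.preimage_mem_nhds
          (Filter.inter_mem (Metric.ball_mem_nhds _ hR) (Metric.eball_mem_nhds _ hr))), ?_⟩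
    rintro z ⟨hz, hzR, hzr⟩
    change liftedEDist p z e < r
    rw [hd z hz e heφ hzR (Metric.mem_ball_self hR)]
    exact hzr
  · obtain ⟨φ, hφ, heφ, R, hR, -, hd, hs⟩ := hp.exists_sheet hX e
    have : p '' (N ∩ φ.source) ∈ 𝓝 (p e) :=
      hp.isOpenMap.image_mem_nhds (Filter.inter_mem hN (φ.open_source.mem_nhds heφ))
    obtain ⟨r, hr, hrN⟩ := EMetric.mem_nhds_iff.1 this
    refine ⟨min r (ENNReal.ofReal R), lt_min hr (ENNReal.ofReal_pos.2 hR), fun z hz => ?_⟩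
    have hz : liftedEDist p z e < min r (ENNReal.ofReal R) := hz
    have hz1 : p z ∈ Metric.eball (p e) r :=
      (edist_le_liftedEDist z e).trans_lt (hz.trans_le (min_le_left _ _))
    have hz2 : z ∈ φ.source := hs z (by
      rw [liftedEDist_comm]; exact hz.trans_le (min_le_right _ _))
    obtain ⟨w, ⟨hwN, hwφ⟩, hwz⟩ := hrN hz1
    rwa [← φ.injOn hwφ hz2 (by rw [hφ]; exact hwz)]

end Topological

section Metric

variable [MetricSpace E] {p : E → X}

/-- A local isometry preserves the lengths of curves. -/
theorem IsLocalIsometry.eVariationOn_comp (hp : IsLocalIsometry p) {γ : I → E}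
    (hγ : Continuous γ) : eVariationOn (p ∘ γ) univ = eVariationOn γ univ := by
  choose r hr hiso himg using hp
  obtain ⟨δ, hδ, h⟩ := lebesgue_number_lemma_of_metric (isCompact_univ (X := I))
    (c := fun e => γ ⁻¹' Metric.ball e (r e)) (fun e => Metric.isOpen_ball.preimage hγ)
    fun t _ => mem_iUnion.2 ⟨γ t, Metric.mem_ball_self (hr _)⟩
  have key : ∀ a b : I, |(a : ℝ) - b| ≤ δ / 2 → edist (p (γ a)) (p (γ b)) = edist (γ a) (γ b) := by
    intro a b hab
    obtain ⟨e, he⟩ := h b trivial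
    have ha : a ∈ Metric.ball b δ := by
      rw [Metric.mem_ball, Subtype.dist_eq, Real.dist_eq]; linarith
    rw [edist_dist, edist_dist, hiso e _ (he ha) _ (he (Metric.mem_ball_self hδ))]
  refine le_antisymm ?_ ?_
  · simpa using eVariationOn_univ_le_mul_of_edist_le (C := 1) (half_pos hδ)
      fun a b hab => by rw [one_mul]; exact (key a b hab).le
  · simpa using eVariationOn_univ_le_mul_of_edist_le (C := 1) (half_pos hδ)
      fun a b hab => by rw [one_mul]; exact (key a b hab).ge

theorem IsLocalIsometry.edist_eq_liftedEDist (hp : IsLocalIsometry p) (hE : IsLengthSpace E)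
    (x y : E) : edist x y = liftedEDist p x y := by
  rw [hE x y]
  exact iInf_congr fun γ => (hp.eVariationOn_comp γ.continuous).symm

theorem IsCoveringMap.isLocalIsometry (hp : IsCoveringMap p) (hX : IsLengthSpace X)
    (h : ∀ x y : E, edist x y = liftedEDist p x y) : IsLocalIsometry p := by
  intro e
  obtain ⟨φ, hφ, heφ, R, hR, hRt, hd, hs⟩ := hp.exists_sheet hX e
  have hball : ∀ y ∈ Metric.ball e R, y ∈ φ.source ∧ p y ∈ Metric.ball (p e) R := by
    intro y hy
    have hy' : liftedEDist p e y < ENNReal.ofReal R := by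
      rw [← h, edist_dist, ENNReal.ofReal_lt_ofReal_iff hR, dist_comm]; exact hy
    refine ⟨hs y hy', ?_⟩
    have := (edist_le_liftedEDist e y).trans_lt hy'
    rwa [edist_dist, ENNReal.ofReal_lt_ofReal_iff hR, dist_comm] at this
  have hdist : ∀ x ∈ φ.source, ∀ y ∈ φ.source, p x ∈ Metric.ball (p e) R →
      p y ∈ Metric.ball (p e) R → dist (p x) (p y) = dist x y := fun x hx y hy hxR hyR => by
    rw [dist_edist, dist_edist, h, hd x hx y hy hxR hyR]
  refine ⟨R, hR, fun y hy z hz => hdist y (hball y hy).1 z (hball z hz).1 (hball y hy).2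
    (hball z hz).2, Subset.antisymm ?_ fun x hx => ?_⟩
  · rintro _ ⟨y, hy, rfl⟩; exact (hball y hy).2
  · have hx' := hRt hx
    have hpx : p (φ.symm x) = x := by rw [← hφ, φ.right_inv hx']
    refine ⟨φ.symm x, ?_, hpx⟩
    rw [Metric.mem_ball, ← hdist _ (φ.map_target hx') e heφ (by rwa [hpx])
      (Metric.mem_ball_self hR), hpx]
    exact hx

theorem IsLocalIsometry.isLengthSpace (hp : IsLocalIsometry p)
    (h : ∀ x y : E, edist x y = liftedEDist p x y) : IsLengthSpace E := fun x y => by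
  rw [h]
  exact iInf_congr fun γ => hp.eVariationOn_comp γ.continuous

/-- Completeness lifts to coverings: the tail of a Cauchy sequence lies in one sheet over an evenly
covered neighborhood of the limit of its projection. -/
theorem IsLocalIsometry.completeSpace [CompleteSpace X] (hp : IsLocalIsometry p)
    (hcov : IsCoveringMap p) (hE : IsLengthSpace E) : CompleteSpace E := by
  have hle : ∀ x y, dist (p x) (p y) ≤ dist x y := fun x y => by
    have := edist_le_liftedEDist (p := p) x y
    rwa [← hp.edist_eq_liftedEDist hE, edist_dist, edist_dist,
      ENNReal.ofReal_le_ofReal_iff dist_nonneg] at this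
  refine Metric.complete_of_cauchySeq_tendsto fun q hq => ?_
  have hpq : CauchySeq fun n => p (q n) := by
    rw [Metric.cauchySeq_iff] at hq ⊢
    intro ε hε
    obtain ⟨N, hN⟩ := hq ε hε
    exact ⟨N, fun m hm n hn => (hle _ _).trans_lt (hN m hm n hn)⟩
  obtain ⟨x, hx⟩ := cauchySeq_tendsto_of_complete hpq
  obtain ⟨hdisc, U, hxU, hU, hfU, H, hH⟩ := hcov x
  obtain ⟨r, hr, hrU⟩ := Metric.mem_nhds_iff.1 (hU.mem_nhds hxU)
  obtain ⟨N₁, hN₁⟩ := Metric.tendsto_atTop.1 hx (r / 2) (half_pos hr)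
  obtain ⟨N₂, hN₂⟩ := Metric.cauchySeq_iff.1 hq (r / 2) (half_pos hr)
  set N := max N₁ N₂ with hN
  have hmem : ∀ n ≥ N, p (q n) ∈ U := fun n hn => hrU <| by
    have := hN₁ n ((le_max_left _ _).trans hn)
    rw [Metric.mem_ball]; linarith
  let i := (H ⟨q N, hmem N le_rfl⟩).2
  -- points of the sequence far out lie in one sheet, as they are joined by short paths
  have hsheet : ∀ n (hn : n ≥ N), (H ⟨q n, hmem n hn⟩).2 = i := by
    intro n hn
    have hd : edist (q N) (q n) < ENNReal.ofReal (r / 2) := by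
      rw [edist_dist, ENNReal.ofReal_lt_ofReal_iff (half_pos hr)]
      exact hN₂ N (le_max_right _ _) n ((le_max_right _ _).trans hn)
    obtain ⟨γ, hγ⟩ := hE.exists_path hd
    rw [← hp.eVariationOn_comp γ.continuous] at hγ
    have hγU : ∀ t, p (γ t) ∈ U := fun t => hrU <| by
      have h1 := (edist_source_le (p ∘ γ) t).trans_lt hγ
      simp only [Function.comp_apply] at h1
      rw [γ.source, edist_dist, ENNReal.ofReal_lt_ofReal_iff (half_pos hr)] at h1
      have h2 := hN₁ N (le_max_left _ _)
      rw [Metric.mem_ball]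
      linarith [dist_triangle (p (γ t)) (p (q N)) x]
    have hc : Continuous fun t : I => (H ⟨γ t, hγU t⟩).2 :=
      continuous_snd.comp (H.continuous.comp (γ.continuous.subtype_mk hγU))
    have := PreconnectedSpace.constant inferInstance hc (x := 1) (y := 0)
    simpa only [γ.source, γ.target] using this
  refine ⟨(H.symm (⟨x, hxU⟩, i)).1, ?_⟩
  have hlim : Filter.Tendsto (fun n => (⟨p (q (n + N)), hmem _ (Nat.le_add_left _ _)⟩ : U))
      Filter.atTop (𝓝 ⟨x, hxU⟩) :=
    tendsto_subtype_rng.2 ((Filter.tendsto_add_atTop_iff_nat N).2 hx)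
  have hlim2 := (continuous_subtype_val.comp H.symm.continuous).continuousAt.tendsto.comp
    (hlim.prodMk_nhds (tendsto_const_nhds (x := i)))
  rw [← Filter.tendsto_add_atTop_iff_nat N]
  refine hlim2.congr fun n => ?_
  have hn : n + N ≥ N := Nat.le_add_left _ _
  have : (⟨⟨p (q (n + N)), hmem _ hn⟩, i⟩ : U × _) = H ⟨q (n + N), hmem _ hn⟩ :=
    Prod.ext (Subtype.ext (hH ⟨q (n + N), hmem _ hn⟩).symm) (hsheet _ hn).symm
  simp only [Function.comp_apply, this, H.symm_apply_apply]

theorem IsLocalIsometry.exists_ball (hp : IsLocalIsometry p) (e : E) :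
    ∃ r > 0, ∀ r' ≤ r, (∀ y ∈ Metric.ball e r', ∀ z ∈ Metric.ball e r',
      dist (p y) (p z) = dist y z) ∧ p '' Metric.ball e r' = Metric.ball (p e) r' := by
  obtain ⟨r, hr, hiso, himg⟩ := hp e
  refine ⟨r, hr, fun r' hr' => ⟨fun y hy z hz => hiso y (Metric.ball_subset_ball hr' hy) z
    (Metric.ball_subset_ball hr' hz), Subset.antisymm ?_ fun x hx => ?_⟩⟩
  · rintro _ ⟨y, hy, rfl⟩
    rw [Metric.mem_ball, hiso y (Metric.ball_subset_ball hr' hy) e (Metric.mem_ball_self hr)]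
    exact hy
  · have : x ∈ p '' Metric.ball e r := by rw [himg]; exact Metric.ball_subset_ball hr' hx
    obtain ⟨y, hy, rfl⟩ := this
    refine ⟨y, ?_, rfl⟩
    rw [Metric.mem_ball, ← hiso y hy e (Metric.mem_ball_self hr)]
    exact hx

theorem IsGeodesic.comp_isometryOn {U : Set E} {γ : I → E} (hγ : IsGeodesic γ)
    (hU : ∀ t, γ t ∈ U) (hp : ∀ y ∈ U, ∀ z ∈ U, dist (p y) (p z) = dist y z) :
    IsGeodesic fun t => p (γ t) := by
  obtain ⟨c, hc, h⟩ := hγ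
  exact ⟨c, hc, fun s t => by rw [hp _ (hU s) _ (hU t), h]⟩

theorem IsGeodesicallyConvex.of_image {U : Set E}
    (hp : ∀ y ∈ U, ∀ z ∈ U, dist (p y) (p z) = dist y z) (h : IsGeodesicallyConvex (p '' U)) :
    IsGeodesicallyConvex U := by
  intro y hy z hz
  obtain ⟨γ, hγ, hγU⟩ := h _ (mem_image_of_mem p hy) _ (mem_image_of_mem p hz)
  choose γ' hγ'U hγ' using hγU
  have hinj : ∀ a ∈ U, ∀ b ∈ U, p a = p b → a = b := fun a ha b hb hab => by
    rw [← dist_eq_zero, ← hp a ha b hb, hab, dist_self]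
  obtain ⟨c, hc, hd⟩ := hγ.isGeodesic
  refine ⟨γ', ⟨⟨c, hc, fun s t => ?_⟩, hinj _ (hγ'U 0) _ hy ?_, hinj _ (hγ'U 1) _ hz ?_⟩, hγ'U⟩
  · rw [← hp _ (hγ'U s) _ (hγ'U t), hγ', hγ', hd]
  · rw [hγ', hγ.source]
  · rw [hγ', hγ.target]

theorem IsConvexMetricOn.of_image {U : Set E}
    (hp : ∀ y ∈ U, ∀ z ∈ U, dist (p y) (p z) = dist y z) (h : IsConvexMetricOn (p '' U)) :
    IsConvexMetricOn U := by
  refine ⟨IsGeodesicallyConvex.of_image hp h.1, fun γ₁ γ₂ h₁ h₂ m₁ m₂ t => ?_⟩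
  have := h.2 _ _ (h₁.comp_isometryOn m₁ hp) (h₂.comp_isometryOn m₂ hp)
    (fun t => mem_image_of_mem p (m₁ t)) (fun t => mem_image_of_mem p (m₂ t)) t
  rwa [hp _ (m₁ _) _ (m₂ _), hp _ (m₁ _) _ (m₂ _), hp _ (m₁ _) _ (m₂ _)] at this

theorem IsLocalIsometry.isLocallyConvexMetric (hp : IsLocalIsometry p)
    (hX : IsLocallyConvexMetric X) : IsLocallyConvexMetric E := by
  intro e
  obtain ⟨r, hr, h⟩ := hp.exists_ball e
  obtain ⟨r', hr', h'⟩ := hX.exists_ball (p e)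
  obtain ⟨h1, h2⟩ := h (min r r') (min_le_left _ _)
  exact ⟨_, Metric.ball_mem_nhds e (lt_min hr hr'),
    IsConvexMetricOn.of_image h1 (by rw [h2]; exact h' _ (min_le_right _ _))⟩

end Metric

theorem IsLiftedLengthMetric.edist_eq {tE : TopologicalSpace E} {p : E → X} {m : MetricSpace E}
    (h : @IsLiftedLengthMetric E X tE _ p m) (x y : E) :
    m.edist x y = @liftedEDist X _ E tE p x y := by
  obtain ⟨htop, hlen, hiso⟩ := h
  subst htop
  exact hiso.edist_eq_liftedEDist hlen x y

theorem existsUnique_isLiftedLengthMetric [tE : TopologicalSpace E] [PreconnectedSpace E]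
    {p : E → X} (hp : IsCoveringMap p) (hX : IsLengthSpace X) :
    ∃! m : MetricSpace E, IsLiftedLengthMetric p m := by
  obtain ⟨m, hm, hd⟩ := hp.exists_metricSpace hX
  have hlift : @IsLiftedLengthMetric E X tE _ p m := by
    subst hm
    have hiso := hp.isLocalIsometry hX hd
    exact ⟨rfl, hiso.isLengthSpace hd, hiso⟩
  refine ⟨m, hlift, fun m' (hm' : @IsLiftedLengthMetric E X tE _ p m') => MetricSpace.ext ?_⟩
  ext x y
  have e1 : @dist E m'.toDist x y = (m'.edist x y).toReal :=
    @dist_edist E m'.toPseudoMetricSpace x y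
  have e2 : @dist E m.toDist x y = (m.edist x y).toReal := @dist_edist E m.toPseudoMetricSpace x y
  rw [e1, e2, IsLiftedLengthMetric.edist_eq hm', IsLiftedLengthMetric.edist_eq hlift]

end LiftedMetric

/-! ### Simply connected, locally convex spaces are globally convex -/

section Globalization

variable {X : Type u} [MetricSpace X]

/-- A simply connected space is the base of a trivial exponential covering: geodesics from `x₀` can
be chosen continuously in their endpoint, and every local geodesic from `x₀` is the chosen one. -/
theorem exists_continuous_localGeodesics [CompleteSpace X] [SimplyConnectedSpace X]
    (hX : IsLengthSpace X) (hc : IsLocallyConvexMetric X) (x₀ : X) :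
    ∃ s : X → localGeodesicsFrom x₀, Continuous s ∧ (∀ x, (s x).1 1 = x) ∧
      (∀ t, (s x₀).1 t = x₀) ∧ ∀ γ : localGeodesicsFrom x₀, s (γ.1 1) = γ := by
  have := completeSpace_localGeodesicsFrom hc x₀
  have := contractibleSpace_localGeodesicsFrom x₀
  have := hX.locallyPathConnectedSpace
  have hcov := (isLocalIsometry_geodesicExp hc x₀).isCoveringMap hc
  obtain ⟨s, ⟨hs0, hs⟩, -⟩ := hcov.existsUnique_continuousMap_lifts (ContinuousMap.id X) x₀
    (localGeodesicsFrom.const x₀) rfl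
  refine ⟨s, s.continuous, fun x => congrFun hs x, fun t => by rw [hs0]; rfl, fun γ => ?_⟩
  exact congrFun (hcov.eq_of_comp_eq (g₁ := fun γ => s (geodesicExp x₀ γ)) (g₂ := id)
    (s.continuous.comp (continuous_geodesicExp x₀)) continuous_id
    (funext fun γ => congrFun hs _) (localGeodesicsFrom.const x₀) hs0) γ

/-- Local geodesics with a common origin spread at most linearly: this is true at small scales, and
is summed up along a nearly shortest curve joining the endpoints. -/
theorem IsLocalGeodesic.dist_le_of_simplyConnected [CompleteSpace X] [SimplyConnectedSpace X]
    (hX : IsLengthSpace X) (hc : IsLocallyConvexMetric X) {γ₁ γ₂ : I → X}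
    (h₁ : IsLocalGeodesic γ₁) (h₂ : IsLocalGeodesic γ₂) (h0 : γ₁ 0 = γ₂ 0) (t : I) :
    dist (γ₁ t) (γ₂ t) ≤ t * dist (γ₁ 1) (γ₂ 1) := by
  obtain ⟨s, hs, hs1, -, hsu⟩ := exists_continuous_localGeodesics hX hc (γ₁ 0)
  have e₁ : (s (γ₁ 1)).1 t = γ₁ t := congrArg (fun g : localGeodesicsFrom (γ₁ 0) => g.1 t)
    (hsu ⟨⟨γ₁, h₁.continuous⟩, h₁, rfl⟩)
  have e₂ : (s (γ₂ 1)).1 t = γ₂ t := congrArg (fun g : localGeodesicsFrom (γ₁ 0) => g.1 t)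
    (hsu ⟨⟨γ₂, h₂.continuous⟩, h₂, h0.symm⟩)
  rw [← e₁, ← e₂]
  have ht0 : (0 : ℝ) ≤ t := t.2.1
  have key : ∀ γ : Path (γ₁ 1) (γ₂ 1), edist ((s (γ₁ 1)).1 t) ((s (γ₂ 1)).1 t) ≤
      ENNReal.ofReal t * eVariationOn (γ : I → X) univ := by
    intro γ
    choose ε hε hU using fun g : localGeodesicsFrom (γ₁ 0) => hc.exists_ball_curve_subset g.1
    have hsγ : Continuous fun r : I => s (γ r) := hs.comp γ.continuous
    obtain ⟨δ, hδ, h⟩ := lebesgue_number_lemma_of_metric (isCompact_univ (X := I))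
      (c := fun g => (fun r => s (γ r)) ⁻¹' Metric.ball g (ε g))
      (fun g => Metric.isOpen_ball.preimage hsγ)
      fun r _ => mem_iUnion.2 ⟨s (γ r), Metric.mem_ball_self (hε _)⟩
    have hloc : ∀ a b : I, |(a : ℝ) - b| ≤ δ / 2 →
        edist ((s (γ a)).1 t) ((s (γ b)).1 t) ≤ ENNReal.ofReal t * edist (γ a) (γ b) := by
      intro a b hab
      obtain ⟨g, hg⟩ := h b trivial
      have ha : a ∈ Metric.ball b δ := by
        rw [Metric.mem_ball, Subtype.dist_eq, Real.dist_eq]; linarith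
      have := dist_apply_le_of_mem_ball (hU g) (s (γ a)).2.1 (s (γ b)).2.1
        ((s (γ a)).2.2.trans (s (γ b)).2.2.symm) (hg ha) (hg (Metric.mem_ball_self hδ)) t
      rw [hs1, hs1] at this
      rw [edist_dist, edist_dist, ← ENNReal.ofReal_mul ht0]
      exact ENNReal.ofReal_le_ofReal this
    have h1 := edist_source_le (fun r => (s (γ r)).1 t) 1
    simp only [γ.source, γ.target] at h1
    rw [edist_comm]
    exact h1.trans (eVariationOn_univ_le_mul_of_edist_le (half_pos hδ) hloc)
  refine le_of_forall_pos_le_add fun η hη => ?_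
  obtain ⟨γ, hγ⟩ := hX.exists_path (x := γ₁ 1) (y := γ₂ 1)
    (c := ENNReal.ofReal (dist (γ₁ 1) (γ₂ 1) + η)) (by
      rw [edist_dist, ENNReal.ofReal_lt_ofReal_iff (by positivity)]; linarith)
  have h1 := (key γ).trans (mul_le_mul_right hγ.le _)
  rw [← ENNReal.ofReal_mul ht0, edist_dist, ENNReal.ofReal_le_ofReal_iff (by positivity)] at h1
  nlinarith [t.2.2]

/-- A curve is no longer than the speed it has at small scales. -/
theorem dist_endpoints_le_of_local_speed {γ : I → X} {c δ : ℝ} (hδ : 0 < δ)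
    (h : ∀ s t : I, |(s : ℝ) - t| ≤ δ → dist (γ s) (γ t) = c * |(s : ℝ) - t|) (hc : 0 ≤ c) :
    dist (γ 0) (γ 1) ≤ c := by
  have h1 := eVariationOn_univ_le_mul_of_edist_le (f := γ) (g := ((↑) : I → ℝ))
    (C := ENNReal.ofReal c) hδ fun a b hab => by
      rw [edist_dist, edist_dist, h a b hab, ENNReal.ofReal_mul hc, Real.dist_eq]
  have h2 : eVariationOn ((↑) : I → ℝ) univ ≤ ENNReal.ofReal 1 := by
    have := (MonotoneOn.eVariationOn_eq (f := ((↑) : I → ℝ)) (s := univ) (a := 0) (b := 1)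
      (fun a _ b _ hab => hab) (mem_univ _) (mem_univ _)).le
    rwa [univ_inter, ← unitInterval.univ_eq_Icc, Icc.coe_one, Icc.coe_zero, sub_zero] at this
  have h3 := (edist_source_le γ 1).trans (h1.trans (mul_le_mul_right h2 _))
  rw [← ENNReal.ofReal_mul hc, mul_one, edist_dist, ENNReal.ofReal_le_ofReal_iff hc,
    dist_comm] at h3
  exact h3

/-- Comparing a local geodesic with the constant one at its origin shows that its endpoints are at
a distance equal to its speed. -/
theorem IsLocalGeodesic.isGeodesic_of_simplyConnected [CompleteSpace X] [SimplyConnectedSpace X]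
    (hX : IsLengthSpace X) (hc : IsLocallyConvexMetric X) {γ : I → X}
    (h : IsLocalGeodesic γ) : IsGeodesic γ := by
  -- the speed of a local geodesic is the distance of its endpoints
  have key : ∀ (γ : I → X) (c δ : ℝ), 0 ≤ c → 0 < δ →
      (∀ s t : I, |(s : ℝ) - t| ≤ δ → dist (γ s) (γ t) = c * |(s : ℝ) - t|) →
      dist (γ 0) (γ 1) = c := by
    intro γ c δ hc0 hδ h
    refine le_antisymm (dist_endpoints_le_of_local_speed hδ h hc0) ?_
    obtain ⟨η, hη, hη1⟩ := exists_between (lt_min hδ one_pos)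
    rw [lt_min_iff] at hη1
    let e : I := ⟨η, hη.le, hη1.2.le⟩
    have h1 := IsLocalGeodesic.dist_le_of_simplyConnected hX hc ⟨c, hc0, δ, hδ, h⟩
      (isGeodesic_const (γ 0)).isLocalGeodesic rfl e
    have h2 : |(e : ℝ) - (0 : I)| = η := by simp [e, abs_of_pos hη]
    rw [h e 0 (by rw [h2]; exact hη1.1.le), h2, dist_comm] at h1
    have h3 : c * η ≤ dist (γ 0) (γ 1) * η := by linarith
    exact le_of_mul_le_mul_right h3 hη
  obtain ⟨c, hc0, δ, hδ, h⟩ := h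
  have main : ∀ a b : I, a ≤ b → dist (γ a) (γ b) = c * |(a : ℝ) - b| := by
    intro a b hab
    have hab' : (0 : ℝ) ≤ b - a := sub_nonneg.2 hab
    have hb1 : (b : ℝ) - a ≤ 1 := by linarith [a.2.1, b.2.2]
    have := key (fun t => γ (Icc.convexComb a b t)) (c * (b - a)) δ (mul_nonneg hc0 hab') hδ
      (fun s t hst => by
        have e : |(Icc.convexComb a b s : ℝ) - Icc.convexComb a b t| = (b - a) * |(s : ℝ) - t| := by
          simp only [Icc.coe_convexComb]
          rw [show (1 - (s : ℝ)) * a + s * b - ((1 - t) * a + t * b) = (b - a) * (s - t) by ring,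
            abs_mul, abs_of_nonneg hab']
        rw [h _ _ (by rw [e]; nlinarith [abs_nonneg ((s : ℝ) - t)]), e, mul_assoc])
    simp only [Icc.convexComb_zero, Icc.convexComb_one] at this
    rw [this, abs_sub_comm, abs_of_nonneg hab']
  refine ⟨c, hc0, fun s t => ?_⟩
  rcases le_total s t with hst | hst
  · exact main s t hst
  · rw [dist_comm, abs_sub_comm]; exact main t s hst

/-- Two geodesics are compared through the diagonal from the origin of the first to the end of the
second. -/
theorem isGloballyConvexMetric_of_simplyConnected [CompleteSpace X] [SimplyConnectedSpace X]
    (hX : IsLengthSpace X) (hc : IsLocallyConvexMetric X) : IsGloballyConvexMetric X := by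
  have hex : ∀ x y : X, ∃ γ : I → X, IsGeodesicFromTo γ x y := fun x y => by
    obtain ⟨s, -, hs1, -, -⟩ := exists_continuous_localGeodesics hX hc x
    exact ⟨(s y).1, (s y).2.1.isGeodesic_of_simplyConnected hX hc, (s y).2.2, hs1 y⟩
  refine ⟨fun x _ y _ => ?_, fun γ₁ γ₂ h₁ h₂ _ _ t => ?_⟩
  · obtain ⟨γ, hγ⟩ := hex x y
    exact ⟨γ, hγ, fun _ => trivial⟩
  · obtain ⟨γ₃, h₃⟩ := hex (γ₁ 0) (γ₂ 1)
    have e₁ := h₁.isLocalGeodesic.dist_le_of_simplyConnected hX hc h₃.isGeodesic.isLocalGeodesic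
      h₃.source.symm t
    have e₂ := h₃.isGeodesic.symm.isLocalGeodesic.dist_le_of_simplyConnected hX hc
      h₂.symm.isLocalGeodesic (by simp [h₃.target]) (unitInterval.symm t)
    simp only [unitInterval.symm_symm, unitInterval.symm_one, unitInterval.coe_symm_eq,
      h₃.source] at e₂
    rw [h₃.target] at e₁
    linarith [dist_triangle (γ₁ t) (γ₃ t) (γ₂ t)]

theorem IsGloballyConvexMetric.isUniquelyGeodesic (h : IsGloballyConvexMetric X) :
    IsUniquelyGeodesic X := fun x y => by
  obtain ⟨γ, hγ, -⟩ := h.1 x trivial y trivial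
  refine ⟨γ, hγ, fun γ' hγ' => h.eq_of_endpoints hγ'.isGeodesic hγ.isGeodesic (fun _ => trivial)
    (fun _ => trivial) ?_ ?_⟩
  · rw [hγ.source, hγ'.source]
  · rw [hγ.target, hγ'.target]

end Globalization

/-! ### The CN inequality -/

section CN

variable {X : Type u} [MetricSpace X]

/-- Stewart's identity. -/
theorem dist_lineMap_sq (a b c : EPlane) (t : ℝ) :
    dist a (AffineMap.lineMap b c t) ^ 2 =
      (1 - t) * dist a b ^ 2 + t * dist a c ^ 2 - t * (1 - t) * dist b c ^ 2 := by
  have e1 : a - AffineMap.lineMap b c t = (1 - t) • (a - b) + t • (a - c) := by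
    rw [AffineMap.lineMap_apply_module]; module
  have e2 : b - c = (a - c) - (a - b) := by abel
  rw [dist_eq_norm, dist_eq_norm, dist_eq_norm, dist_eq_norm, e1, e2, norm_add_sq_real,
    norm_sub_sq_real (a - c) (a - b), norm_smul, norm_smul, inner_smul_left, inner_smul_right,
    mul_pow, mul_pow, Real.norm_eq_abs, Real.norm_eq_abs, sq_abs, sq_abs,
    real_inner_comm (a - b) (a - c)]
  simp only [conj_trivial]
  ring

theorem exists_isComparisonTriangle (v : Fin 3 → X) :
    ∃ w : Fin 3 → EPlane, IsComparisonTriangle v w := by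
  set a := dist (v 0) (v 1) with ha
  set b := dist (v 0) (v 2) with hb
  set c := dist (v 1) (v 2) with hc
  have ha0 : 0 ≤ a := dist_nonneg
  have hb0 : 0 ≤ b := dist_nonneg
  have hc0 : 0 ≤ c := dist_nonneg
  have t1 : a ≤ b + c := by
    have := dist_triangle_right (v 0) (v 1) (v 2); linarith
  have t2 : b ≤ a + c := by
    have := dist_triangle (v 0) (v 1) (v 2); linarith
  have t3 : c ≤ a + b := by
    have := dist_triangle_left (v 1) (v 2) (v 0); linarith
  -- coordinates of the third vertex, the first side lying on the first axis
  obtain ⟨x, y, h1, h2⟩ : ∃ x y : ℝ, x ^ 2 + y ^ 2 = b ^ 2 ∧ (a - x) ^ 2 + y ^ 2 = c ^ 2 := by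
    rcases ha0.eq_or_lt with h | h
    · refine ⟨b, 0, by ring, ?_⟩
      have : b = c := by rw [← h] at t1 t2 t3; linarith
      rw [← h, this]; ring
    · set x := (a ^ 2 + b ^ 2 - c ^ 2) / (2 * a) with hx
      have hxa : 2 * a * x = a ^ 2 + b ^ 2 - c ^ 2 := by rw [hx]; field_simp
      have hxb : |x| ≤ b := by
        rw [abs_le]; constructor
        · have : 0 ≤ 2 * a * (x + b) := by nlinarith
          nlinarith
        · have : 0 ≤ 2 * a * (b - x) := by nlinarith
          nlinarith
      have hy : 0 ≤ b ^ 2 - x ^ 2 := by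
        have := abs_le.1 hxb
        nlinarith
      refine ⟨x, √(b ^ 2 - x ^ 2), ?_, ?_⟩ <;> rw [Real.sq_sqrt hy]
      · ring
      · linarith
  have d1 : dist (!₂[0, 0] : EPlane) !₂[a, 0] = a := by
    rw [EuclideanSpace.dist_eq, Real.sqrt_eq_iff_eq_sq (by positivity) ha0]
    simp [Fin.sum_univ_two, Real.dist_eq, sq_abs]
  have d2 : dist (!₂[0, 0] : EPlane) !₂[x, y] = b := by
    rw [EuclideanSpace.dist_eq, Real.sqrt_eq_iff_eq_sq (by positivity) hb0]
    simpa [Fin.sum_univ_two, Real.dist_eq, sq_abs] using h1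
  have d3 : dist (!₂[a, 0] : EPlane) !₂[x, y] = c := by
    rw [EuclideanSpace.dist_eq, Real.sqrt_eq_iff_eq_sq (by positivity) hc0]
    simpa [Fin.sum_univ_two, Real.dist_eq, sq_abs] using h2
  refine ⟨![!₂[0, 0], !₂[a, 0], !₂[x, y]], fun i j => ?_⟩
  fin_cases i <;> fin_cases j <;> simp only [Fin.zero_eta, Fin.mk_one, Fin.reduceFinMk,
    Matrix.cons_val_zero, Matrix.cons_val_one, Matrix.cons_val, dist_self]
  · exact d1
  · exact d2
  · rw [dist_comm, d1, ha, dist_comm]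
  · exact d3
  · rw [dist_comm, d2, hb, dist_comm]
  · rw [dist_comm, d3, hc, dist_comm]

/-- The CN inequality of Bruhat and Tits on a geodesically convex set: along a geodesic, the squared
distance from a point is at least as convex as in the Euclidean plane. -/
def IsCNOn (U : Set X) : Prop :=
  IsGeodesicallyConvex U ∧
    ∀ p ∈ U, ∀ γ : I → X, IsGeodesic γ → (∀ t, γ t ∈ U) → ∀ t : I,
      dist p (γ t) ^ 2 ≤ (1 - (t : ℝ)) * dist p (γ 0) ^ 2 + t * dist p (γ 1) ^ 2 -
        t * (1 - t) * dist (γ 0) (γ 1) ^ 2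

theorem IsCAT0.isCNOn {U : Set X} (h : IsCAT0 U) : IsCNOn U := by
  refine ⟨fun x hx y hy => ?_, fun p hp γ hγ hγU t => ?_⟩
  · obtain ⟨γ, ⟨c, hc, hd⟩, h0, h1⟩ := h.1 ⟨x, hx⟩ ⟨y, hy⟩
    exact ⟨fun t => γ t, ⟨⟨c, hc, hd⟩, congrArg Subtype.val h0, congrArg Subtype.val h1⟩,
      fun t => (γ t).2⟩
  · let P : U := ⟨p, hp⟩
    let γ' : I → U := fun t => ⟨γ t, hγU t⟩
    obtain ⟨c, hc, hd⟩ := hγ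
    have hγ' : IsGeodesicFromTo γ' (γ' 0) (γ' 1) := ⟨⟨c, hc, hd⟩, rfl, rfl⟩
    obtain ⟨α, hα⟩ := h.1 P (γ' 0)
    obtain ⟨β, hβ⟩ := h.1 (γ' 1) P
    obtain ⟨w, hw⟩ := exists_isComparisonTriangle ![P, γ' 0, γ' 1]
    have htri : IsGeodesicTriangle ![P, γ' 0, γ' 1] ![α, γ', β] := by
      intro i
      fin_cases i
      · exact hα
      · exact hγ'
      · exact hβ
    have key := h.2 _ _ w htri hw 0 1 0 t
    have e0 : (![α, γ', β] 0) 0 = P := hα.source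
    rw [e0, Icc.coe_zero, AffineMap.lineMap_apply_zero] at key
    have e1 : dist P ((![α, γ', β] 1) t) = dist p (γ t) := rfl
    rw [e1] at key
    have h01 : dist (w 0) (w 1) = dist p (γ 0) := hw 0 1
    have h02 : dist (w 0) (w 2) = dist p (γ 1) := hw 0 2
    have h12 : dist (w 1) (w 2) = dist (γ 0) (γ 1) := hw 1 2
    have := pow_le_pow_left₀ dist_nonneg key 2
    rw [dist_lineMap_sq] at this
    rw [show (1 : Fin 3) + 1 = 2 from rfl, h01, h02, h12] at this
    exact this

/-- The CN inequality bounds the distance of geodesics with a common origin; general geodesics are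
compared through a diagonal. -/
theorem IsCNOn.isConvexMetricOn {U : Set X} (h : IsCNOn U) : IsConvexMetricOn U := by
  have key : ∀ γ₁ γ₂ : I → X, IsGeodesic γ₁ → IsGeodesic γ₂ → (∀ t, γ₁ t ∈ U) → (∀ t, γ₂ t ∈ U) →
      γ₁ 0 = γ₂ 0 → ∀ t : I, dist (γ₁ t) (γ₂ t) ≤ t * dist (γ₁ 1) (γ₂ 1) := by
    intro γ₁ γ₂ h₁ h₂ m₁ m₂ h0 t
    have ht0 : (0 : ℝ) ≤ t := t.2.1
    have ht1 : (t : ℝ) ≤ 1 := t.2.2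
    have e1 := h.2 _ (m₁ t) γ₂ h₂ m₂ t
    have e2 := h.2 _ (m₂ 1) γ₁ h₁ m₁ t
    have e3 : dist (γ₁ t) (γ₂ 0) = dist (γ₁ 0) (γ₁ 1) * t := by
      rw [← h0, h₁.dist_eq, Icc.coe_zero, sub_zero, abs_of_nonneg ht0]
    rw [e3] at e1
    rw [h0, dist_comm (γ₂ 1) (γ₂ 0), dist_comm (γ₂ 1) (γ₁ t), dist_comm (γ₂ 1) (γ₁ 1)] at e2
    rw [h0] at e1
    refine abs_le_of_sq_le_sq' ?_ (mul_nonneg ht0 dist_nonneg) |>.2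
    nlinarith [mul_le_mul_of_nonneg_left e2 ht0]
  refine ⟨h.1, fun γ₁ γ₂ h₁ h₂ m₁ m₂ t => ?_⟩
  obtain ⟨γ₃, h₃, m₃⟩ := h.1 _ (m₁ 0) _ (m₂ 1)
  have e₁ := key _ _ h₁ h₃.isGeodesic m₁ m₃ h₃.source.symm t
  have e₂ := key _ _ h₃.isGeodesic.symm h₂.symm (fun _ => m₃ _) (fun _ => m₂ _)
    (by simp [h₃.target]) (unitInterval.symm t)
  simp only [unitInterval.symm_symm, unitInterval.symm_one, unitInterval.coe_symm_eq,
    h₃.source] at e₂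
  rw [h₃.target] at e₁
  linarith [dist_triangle (γ₁ t) (γ₃ t) (γ₂ t)]

theorem IsCNOn.ball {U : Set X} (hU : IsCNOn U) {x : X} {r : ℝ} (h : Metric.ball x r ⊆ U) :
    IsCNOn (Metric.ball x r) :=
  ⟨(hU.isConvexMetricOn.ball h).1, fun p hp γ hγ hγU => hU.2 p (h hp) γ hγ fun t => h (hγU t)⟩

theorem IsCNOn.of_image {E : Type v} [MetricSpace E] {p : E → X} {U : Set E}
    (hp : ∀ y ∈ U, ∀ z ∈ U, dist (p y) (p z) = dist y z) (h : IsCNOn (p '' U)) : IsCNOn U := by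
  refine ⟨IsGeodesicallyConvex.of_image hp h.1, fun q hq γ hγ m t => ?_⟩
  have := h.2 _ (mem_image_of_mem p hq) _ (hγ.comp_isometryOn m hp)
    (fun t => mem_image_of_mem p (m t)) t
  rwa [hp _ hq _ (m _), hp _ hq _ (m _), hp _ hq _ (m _), hp _ (m _) _ (m _)] at this

theorem IsLocallyCAT0.exists_isCNOn_ball (hX : IsLocallyCAT0 X) (x : X) :
    ∃ r > 0, ∀ r' ≤ r, IsCNOn (Metric.ball x r') := by
  obtain ⟨r, hr, h⟩ := hX x
  exact ⟨r, hr, fun r' hr' => h.isCNOn.ball (Metric.ball_subset_ball hr')⟩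

theorem IsLocallyCAT0.isLocallyConvexMetric (hX : IsLocallyCAT0 X) : IsLocallyConvexMetric X :=
  fun x => by
    obtain ⟨r, hr, h⟩ := hX.exists_isCNOn_ball x
    exact ⟨_, Metric.ball_mem_nhds x hr, (h r le_rfl).isConvexMetricOn⟩

/-- A space satisfying the CN inequality is CAT(0): the inequality is applied once for each of the
two points of the triangle, against Stewart's identity in the comparison triangle. -/
theorem IsCNOn.isCAT0 (h : IsCNOn (univ : Set X)) : IsCAT0 X := by
  refine ⟨fun x y => ?_, fun v γ w hγ hw i j s t => ?_⟩
  · obtain ⟨γ, hγ, -⟩ := h.1 x trivial y trivial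
    exact ⟨γ, hγ⟩
  have adj : ∀ (i : Fin 3) (s t : I), dist (γ i s) (γ (i + 1) t) ≤
      dist (AffineMap.lineMap (w i) (w (i + 1)) (s : ℝ) : EPlane)
        (AffineMap.lineMap (w (i + 1)) (w (i + 1 + 1)) (t : ℝ)) := by
    intro i s t
    have cn (p : X) (i : Fin 3) (t : I) := h.2 p trivial (γ i) (hγ i).isGeodesic
      (fun _ => trivial) t
    simp only [(hγ _).source, (hγ _).target] at cn
    have st (a : EPlane) (i : Fin 3) (t : I) := dist_lineMap_sq a (w i) (w (i + 1)) t
    refine abs_le_of_sq_le_sq' ?_ dist_nonneg |>.2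
    rw [st _ (i + 1) t, dist_comm _ (w (i + 1)), dist_comm _ (w (i + 1 + 1)), st _ i s, st _ i s]
    have c1 := cn (γ i s) (i + 1) t
    rw [dist_comm _ (v (i + 1)), dist_comm _ (v (i + 1 + 1))] at c1
    have c2 := cn (v (i + 1)) i s
    have c3 := cn (v (i + 1 + 1)) i s
    simp only [hw _ _]
    have ht0 : (0 : ℝ) ≤ t := t.2.1
    have ht1 : (0 : ℝ) ≤ 1 - t := by linarith [t.2.2]
    nlinarith [mul_le_mul_of_nonneg_left c2 ht1, mul_le_mul_of_nonneg_left c3 ht0]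
  have hij : j = i ∨ j = i + 1 ∨ i = j + 1 := by revert i j; decide
  rcases hij with rfl | rfl | rfl
  · rw [(hγ j).isGeodesic.dist_eq, (hγ j).source, (hγ j).target, dist_lineMap_lineMap, hw,
      Real.dist_eq, mul_comm]
  · exact adj i s t
  · rw [dist_comm, dist_comm (AffineMap.lineMap _ _ _ : EPlane)]; exact adj j t s

/-- The four point inequality for the diagonals of a quadrilateral. It follows from evaluating the
CN inequality at the points of the diagonals where those of a Euclidean trapezoid cross. -/
theorem IsCNOn.quadrilateral {U : Set X} (h : IsCNOn U) {a b c d : X} (ha : a ∈ U) (hb : b ∈ U)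
    (hc : c ∈ U) (hd : d ∈ U) :
    dist a d ^ 2 + dist b c ^ 2 ≤ dist a c ^ 2 + dist b d ^ 2 + 2 * (dist a b * dist c d) := by
  rcases (dist_nonneg (x := a) (y := b)).eq_or_lt with h0 | hM
  · rw [← h0, dist_eq_zero.1 h0.symm]; linarith
  rcases (dist_nonneg (x := c) (y := d)).eq_or_lt with h0 | hD
  · rw [← h0, dist_eq_zero.1 h0.symm]; linarith
  obtain ⟨σ₁, h₁, m₁⟩ := h.1 a ha d hd
  obtain ⟨σ₂, h₂, m₂⟩ := h.1 b hb c hc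
  set M := dist a b
  set D := dist c d
  have hMD : 0 < M + D := by positivity
  let l : I := ⟨M / (M + D), by positivity, (div_le_one hMD).2 (by linarith)⟩
  have hl : (l : ℝ) * (M + D) = M := div_mul_cancel₀ _ hMD.ne'
  have hl0 : (0 : ℝ) ≤ l := l.2.1
  have hl1 : (0 : ℝ) ≤ 1 - l := by linarith [l.2.2]
  have e1 := h.2 _ (m₁ l) σ₂ h₂.isGeodesic m₂ l
  have e2 := h.2 _ hb σ₁ h₁.isGeodesic m₁ l
  have e3 := h.2 _ hc σ₁ h₁.isGeodesic m₁ l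
  rw [h₂.source, h₂.target, dist_comm _ b, dist_comm _ c] at e1
  rw [h₁.source, h₁.target, dist_comm b a] at e2
  rw [h₁.source, h₁.target, dist_comm c a] at e3
  have e4 : 0 ≤ dist (σ₁ l) (σ₂ l) ^ 2 := sq_nonneg _
  have e5 : 0 ≤ (1 - (l : ℝ)) ^ 2 * M ^ 2 + (l : ℝ) ^ 2 * D ^ 2 +
      l * (1 - l) * (dist a c ^ 2 + dist b d ^ 2 - dist a d ^ 2 - dist b c ^ 2) := by
    nlinarith [mul_le_mul_of_nonneg_left e2 hl1, mul_le_mul_of_nonneg_left e3 hl0]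
  have f1 : (1 - (l : ℝ)) * (M + D) = D := by linarith
  have e6 : 0 ≤ (M * D) * (2 * (M * D) +
      (dist a c ^ 2 + dist b d ^ 2 - dist a d ^ 2 - dist b c ^ 2)) := by
    have := mul_nonneg e5 (sq_nonneg (M + D))
    have e : ((1 - (l : ℝ)) ^ 2 * M ^ 2 + (l : ℝ) ^ 2 * D ^ 2 +
      l * (1 - l) * (dist a c ^ 2 + dist b d ^ 2 - dist a d ^ 2 - dist b c ^ 2)) * (M + D) ^ 2 =
      ((1 - (l : ℝ)) * (M + D)) ^ 2 * M ^ 2 + (l * (M + D)) ^ 2 * D ^ 2 +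
      (l * (M + D)) * ((1 - l) * (M + D)) *
        (dist a c ^ 2 + dist b d ^ 2 - dist a d ^ 2 - dist b c ^ 2) := by ring
    rw [e, f1, hl] at this
    nlinarith
  have := nonneg_of_mul_nonneg_right e6 (mul_pos hM hD)
  linarith

/-- Comparison for the segment joining the midpoints of two opposite sides of a quadrilateral. -/
theorem IsCNOn.dist_midpoint_sq_le {U : Set X} (h : IsCNOn U) {σ₁ σ₂ : I → X}
    (h₁ : IsGeodesic σ₁) (h₂ : IsGeodesic σ₂) (m₁ : ∀ t, σ₁ t ∈ U) (m₂ : ∀ t, σ₂ t ∈ U) {o : I}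
    (ho : (o : ℝ) = 1 / 2) :
    dist (σ₁ o) (σ₂ o) ^ 2 ≤ (dist (σ₁ 0) (σ₂ 0) ^ 2 + dist (σ₁ 1) (σ₂ 1) ^ 2) / 2 -
      (dist (σ₁ 0) (σ₁ 1) - dist (σ₂ 0) (σ₂ 1)) ^ 2 / 4 := by
  have e1 := h.2 _ (m₁ o) σ₂ h₂ m₂ o
  have e2 := h.2 _ (m₂ 0) σ₁ h₁ m₁ o
  have e3 := h.2 _ (m₂ 1) σ₁ h₁ m₁ o
  have e4 := h.quadrilateral (m₁ 0) (m₁ 1) (m₂ 0) (m₂ 1)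
  rw [dist_comm _ (σ₂ 0), dist_comm _ (σ₂ 1), ho] at e1
  rw [dist_comm _ (σ₁ 0), dist_comm _ (σ₁ 1), ho] at e2 e3
  nlinarith

/-! ### From local to global CAT(0) -/

/-- The inductive step in the exhaustion of a thin triangle. For two long sides with squared lengths
of sum `S`, the triangle cut off at the proportion `θ` has third side `M` and `P` is the distance
from the vertex to its midpoint; `Q` is the distance to the midpoint of the whole third side `D`. -/
theorem sq_le_of_glue {θ P Q S M D d : ℝ} (h0 : 0 < θ) (h1 : θ < 1) (hd : d ≤ P + Q) (hd0 : 0 ≤ d)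
    (hP : P ^ 2 ≤ θ ^ 2 * S / 2 - M ^ 2 / 4)
    (hQ : Q ^ 2 ≤ (1 - θ) ^ 2 * S / 2 - (M - D) ^ 2 / 4) :
    d ^ 2 ≤ S / 2 - D ^ 2 / 4 := by
  have h1' : 0 < 1 - θ := by linarith
  have hpos : 0 < θ * (1 - θ) := mul_pos h0 h1'
  have hdd : d ^ 2 ≤ (P + Q) ^ 2 := pow_le_pow_left₀ hd0 hd 2
  have a1 : θ * (1 - θ) * (P + Q) ^ 2 ≤ (1 - θ) * P ^ 2 + θ * Q ^ 2 := by
    nlinarith [sq_nonneg ((1 - θ) * P - θ * Q)]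
  have a2 := mul_le_mul_of_nonneg_left hP h1'.le
  have a3 := mul_le_mul_of_nonneg_left hQ h0.le
  have a4 : θ * (1 - θ) * D ^ 2 ≤ (1 - θ) * M ^ 2 + θ * (M - D) ^ 2 := by
    nlinarith [sq_nonneg (M - θ * D)]
  have a5 : θ * (1 - θ) * (P + Q) ^ 2 ≤ θ * (1 - θ) * (S / 2 - D ^ 2 / 4) := by nlinarith
  exact hdd.trans (le_of_mul_le_mul_left a5 hpos)

/-- The CN inequality at the midpoint of a short geodesic far away from the base point. The
triangle is exhausted by the triangles cut off at the points dividing its two long sides in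
proportion `i : N`; consecutive ones differ by a small quadrilateral. -/
theorem exists_thin_triangle (hG : IsGloballyConvexMetric X)
    (hL : ∀ x : X, ∃ U ∈ 𝓝 x, IsCNOn U) (p q : X) :
    ∃ ε > 0, ∀ ρ : I → X, IsGeodesic ρ → dist (ρ 0) q < ε → dist (ρ 1) q < ε →
      ∀ o : I, (o : ℝ) = 1 / 2 →
        dist p (ρ o) ^ 2 ≤ (dist p (ρ 0) ^ 2 + dist p (ρ 1) ^ 2) / 2 -
          dist (ρ 0) (ρ 1) ^ 2 / 4 := by
  obtain ⟨c, hc, -⟩ := hG.1 p trivial q trivial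
  choose V hV hVc using hL
  obtain ⟨ε, hε, hleb⟩ := lebesgue_number_lemma_of_metric
    (isCompact_range hc.isGeodesic.lipschitzWith.continuous) (c := fun x => interior (V x))
    (fun _ => isOpen_interior) fun x _ => mem_iUnion.2 ⟨x, mem_interior_iff_mem_nhds.2 (hV x)⟩
  refine ⟨ε / 2, half_pos hε, fun ρ hρ hρ0 hρ1 o ho => ?_⟩
  choose g hg _ using fun x y : X => hG.1 x trivial y trivial
  have huniq : ∀ γ γ' : I → X, IsGeodesic γ → IsGeodesic γ' → γ 0 = γ' 0 → γ 1 = γ' 1 → γ = γ' :=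
    fun γ γ' h h' => hG.eq_of_endpoints h h' (fun _ => trivial) fun _ => trivial
  obtain ⟨N, hN⟩ := exists_nat_gt (max 1 (dist p q / (ε / 2)))
  have hN1 : (1 : ℝ) < N := (le_max_left _ _).trans_lt hN
  have hN0 : (0 : ℝ) < N := by linarith
  have hN2 : dist p q * (1 / N) < ε / 2 := by
    have := (le_max_right _ _).trans_lt hN
    rw [div_lt_iff₀ (by positivity)] at this
    rw [mul_one_div, div_lt_iff₀ hN0]; linarith
  let τ : ℕ → I := fun j => projIcc 0 1 zero_le_one (j / N : ℝ)
  have hτ : ∀ j ≤ N, (τ j : ℝ) = j / N := fun j hj => by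
    have hj' : (j : ℝ) ≤ N := by exact_mod_cast hj
    simp only [τ]
    rw [projIcc_of_mem zero_le_one ⟨by positivity, (div_le_one hN0).2 hj'⟩]
  have hτN : τ N = 1 := Subtype.ext (by rw [hτ N le_rfl]; exact div_self hN0.ne')
  -- the two long sides
  let α : I → X := g p (ρ 0)
  let β : I → X := g p (ρ 1)
  have hα : IsGeodesicFromTo α p (ρ 0) := hg _ _
  have hβ : IsGeodesicFromTo β p (ρ 1) := hg _ _
  have hside : ∀ z, dist z q < ε / 2 → ∀ t, dist (g p z t) (c t) < ε / 2 := fun z hz t => by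
    have := hG.2 _ _ (hg p z).isGeodesic hc.isGeodesic (fun _ => trivial) (fun _ => trivial) t
    rw [(hg p z).source, hc.source, (hg p z).target, hc.target, dist_self, mul_zero,
      zero_add] at this
    exact (this.trans (mul_le_of_le_one_left dist_nonneg t.2.2)).trans_lt hz
  have hnext : ∀ i, i + 1 ≤ N → ∃ U, IsCNOn U ∧ α (τ i) ∈ U ∧ β (τ i) ∈ U ∧ α (τ (i + 1)) ∈ U ∧
      β (τ (i + 1)) ∈ U := fun i hi => by
    obtain ⟨x, hx⟩ := hleb (c (τ i)) (mem_range_self _)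
    have hcc : dist (c (τ (i + 1))) (c (τ i)) < ε / 2 := by
      rw [hc.isGeodesic.dist_eq, hc.source, hc.target, hτ i (by omega), hτ (i + 1) hi]
      have : ((i + 1 : ℕ) : ℝ) / N - i / N = 1 / N := by push_cast; ring
      rw [this, abs_of_pos (by positivity)]
      exact hN2
    have near : ∀ z, dist z q < ε / 2 → g p z (τ i) ∈ V x ∧ g p z (τ (i + 1)) ∈ V x := by
      intro z hz
      refine ⟨interior_subset (hx ?_), interior_subset (hx ?_)⟩ <;> rw [Metric.mem_ball]
      · linarith [hside z hz (τ i)]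
      · linarith [hside z hz (τ (i + 1)),
          dist_triangle (g p z (τ (i + 1))) (c (τ (i + 1))) (c (τ i))]
    exact ⟨V x, hVc x, (near _ hρ0).1, (near _ hρ1).1, (near _ hρ0).2, (near _ hρ1).2⟩
  have hmemU : ∀ U : Set X, IsCNOn U → ∀ x ∈ U, ∀ y ∈ U, ∀ t, g x y t ∈ U := by
    intro U hU x hx y hy t
    obtain ⟨γ, hγ, hγU⟩ := hU.1 x hx y hy
    rw [huniq (g x y) γ (hg x y).isGeodesic hγ.isGeodesic (by rw [(hg x y).source, hγ.source])
      (by rw [(hg x y).target, hγ.target])]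
    exact hγU t
  have hlevel : ∀ z, ∀ i ≤ N, dist p (g p z (τ i)) = dist p z * (i / N) := fun z i hi => by
    have := (hg p z).isGeodesic.dist_eq 0 (τ i)
    rw [(hg p z).source, (hg p z).target, Icc.coe_zero, zero_sub, abs_neg,
      abs_of_nonneg (τ i).2.1, hτ i hi] at this
    exact this
  have hstep : ∀ z, ∀ i, i + 1 ≤ N → dist (g p z (τ i)) (g p z (τ (i + 1))) = dist p z / N :=
    fun z i hi => by
      have := (hg p z).isGeodesic.dist_eq (τ i) (τ (i + 1))
      have e : (i : ℝ) / N - (i + 1 : ℕ) / N = -(1 / N) := by push_cast; ring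
      rw [(hg p z).source, (hg p z).target, hτ i (by omega), hτ (i + 1) hi, e, abs_neg,
        abs_of_pos (by positivity)] at this
      rw [this]; ring
  have main : ∀ i, i + 1 ≤ N →
      dist p (g (α (τ (i + 1))) (β (τ (i + 1))) o) ^ 2 ≤
        (dist p (α (τ (i + 1))) ^ 2 + dist p (β (τ (i + 1))) ^ 2) / 2 -
          dist (α (τ (i + 1))) (β (τ (i + 1))) ^ 2 / 4 := by
    intro i
    induction i with
    | zero =>
      intro hi
      obtain ⟨U, hU, u1, -, u3, u4⟩ := hnext 0 hi
      have hp : α (τ 0) = p := by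
        have : τ 0 = 0 := Subtype.ext (by rw [hτ 0 (by omega)]; simp)
        rw [this, hα.source]
      rw [hp] at u1
      have := hU.2 p u1 _ (hg _ _).isGeodesic (hmemU U hU _ u3 _ u4) o
      rw [(hg _ _).source, (hg _ _).target, ho] at this
      norm_num at this ⊢
      linarith
    | succ i ih =>
      intro hi
      obtain ⟨U, hU, u1, u2, u3, u4⟩ := hnext (i + 1) hi
      have hQ := hU.dist_midpoint_sq_le (hg (α (τ (i + 1))) (β (τ (i + 1)))).isGeodesic
        (hg (α (τ (i + 1 + 1))) (β (τ (i + 1 + 1)))).isGeodesic (hmemU U hU _ u1 _ u2)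
        (hmemU U hU _ u3 _ u4) ho
      have hP := ih (by omega)
      simp only [(hg _ _).source, (hg _ _).target] at hQ
      have hi2 : (0 : ℝ) < i + 2 := by positivity
      have k1 : ∀ z, dist p (g p z (τ (i + 1))) =
          (i + 1) / (i + 2) * dist p (g p z (τ (i + 1 + 1))) := fun z => by
        rw [hlevel z _ (by omega), hlevel z _ hi]; push_cast; field_simp; ring
      have k2 : ∀ z, dist (g p z (τ (i + 1))) (g p z (τ (i + 1 + 1))) =
          (1 - (i + 1) / (i + 2)) * dist p (g p z (τ (i + 1 + 1))) := fun z => by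
        rw [hstep z _ hi, hlevel z _ hi]; push_cast; field_simp; ring
      have kα1 := k1 (ρ 0)
      have kβ1 := k1 (ρ 1)
      have kα2 := k2 (ρ 0)
      have kβ2 := k2 (ρ 1)
      change dist p (α _) = _ * dist p (α _) at kα1
      change dist p (β _) = _ * dist p (β _) at kβ1
      change dist (α _) (α _) = _ * dist p (α _) at kα2
      change dist (β _) (β _) = _ * dist p (β _) at kβ2
      rw [kα1, kβ1] at hP
      rw [kα2, kβ2] at hQ
      refine sq_le_of_glue (θ := (i + 1) / (i + 2))
        (M := dist (α (τ (i + 1))) (β (τ (i + 1)))) (by positivity)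
        ((div_lt_one hi2).2 (by linarith)) (dist_triangle _ _ _) dist_nonneg
        (hP.trans (le_of_eq ?_)) (hQ.trans (le_of_eq ?_)) <;> ring
  have hN' : 1 ≤ N := by
    have : (1 : ℝ) ≤ N := hN1.le
    exact_mod_cast this
  have := main (N - 1) (by omega)
  rw [Nat.sub_add_cancel hN', hτN, hα.target, hβ.target,
    huniq _ ρ (hg _ _).isGeodesic hρ (hg _ _).source (hg _ _).target] at this
  exact this

/-- In a globally convex space, the CN inequality is a local property. -/
theorem isCNOn_univ_of_local (hG : IsGloballyConvexMetric X)
    (hL : ∀ x : X, ∃ U ∈ 𝓝 x, IsCNOn U) : IsCNOn (univ : Set X) := by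
  refine ⟨hG.1, fun p _ γ hγ _ t => ?_⟩
  set L := dist (γ 0) (γ 1) with hLdef
  have hcont : Continuous fun t : I => dist p (γ t) ^ 2 - L ^ 2 * (t : ℝ) ^ 2 := by
    have := hγ.lipschitzWith.continuous
    fun_prop
  -- the CN inequality says that this function lies below its chord
  have := le_chord_of_midpoint_le hcont (fun t ht0 ht1 => ?_) t
  · simp only [Icc.coe_zero, Icc.coe_one] at this
    nlinarith
  have ht0' : (0 : ℝ) < t := ht0
  have ht1' : (0 : ℝ) < 1 - t := by
    have : (t : ℝ) < 1 := ht1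
    linarith
  obtain ⟨ε, hε, h⟩ := exists_thin_triangle hG hL p (γ t)
  have hL0 : 0 ≤ L := dist_nonneg
  obtain ⟨η, hη, hη1⟩ := exists_between (show (0 : ℝ) < min (min (t : ℝ) (1 - t)) (ε / (L + 1)) by
    positivity)
  rw [lt_min_iff, lt_min_iff, lt_div_iff₀ (by positivity)] at hη1
  let a : I := ⟨t - η, by linarith, by linarith⟩
  let b : I := ⟨t + η, by linarith, by linarith⟩
  have hab : a ≤ b := by change (t : ℝ) - η ≤ t + η; linarith
  let o : I := ⟨1 / 2, by norm_num, by norm_num⟩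
  have hmid : Icc.convexComb a b o = t := by
    ext; simp only [Icc.coe_convexComb, a, b, o]; ring
  have hat : dist (γ a) (γ t) < ε := by
    rw [hγ.dist_eq, show (a : ℝ) - t = -η by simp only [a]; ring, abs_neg, abs_of_pos hη]
    nlinarith
  have hbt : dist (γ b) (γ t) < ε := by
    rw [hγ.dist_eq, show (b : ℝ) - t = η by simp only [b]; ring, abs_of_pos hη]
    nlinarith
  have hdab : dist (γ a) (γ b) = L * (2 * η) := by
    rw [hγ.dist_eq, show (a : ℝ) - b = -(2 * η) by simp only [a, b]; ring, abs_neg,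
      abs_of_pos (by positivity)]
  have key := h (fun s => γ (Icc.convexComb a b s))
    (HasSpeedOn.isGeodesic_comp_convexComb hab dist_nonneg fun s _ s' _ => hγ.dist_eq s s')
    (by simpa only [Icc.convexComb_zero] using hat) (by simpa only [Icc.convexComb_one] using hbt)
    o rfl
  simp only [Icc.convexComb_zero, Icc.convexComb_one, hmid, hdab] at key
  refine ⟨a, b, by change (t : ℝ) - η < t; linarith, by simp only [a, b]; ring, ?_⟩
  simp only [a, b] at key ⊢
  nlinarith

end CN

theorem mainTheorem1 {X : Type u} [MetricSpace X] [CompleteSpace X] [PathConnectedSpace X]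
    (hX : IsLengthSpace X) :
    (IsLocallyConvexMetric X ∨ IsLocallyCAT0 X →
      ∃ (E : Type u) (_ : TopologicalSpace E) (p : E → X), IsUniversalCover p) ∧
    ∀ (E : Type v) [TopologicalSpace E] (p : E → X), IsUniversalCover p →
      (∃! m : MetricSpace E, IsLiftedLengthMetric p m) ∧
      ∀ m : MetricSpace E, IsLiftedLengthMetric p m →
        (IsLocallyConvexMetric X →
          @IsGloballyConvexMetric E m ∧ @IsUniquelyGeodesic E m) ∧
        (IsLocallyCAT0 X → @IsCAT0 E m) := by
  refine ⟨fun h => ?_, fun E tE p hp => ⟨?_, fun m hm => ?_⟩⟩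
  · have : Nonempty X := PathConnectedSpace.nonempty
    exact exists_universalCover (h.elim id IsLocallyCAT0.isLocallyConvexMetric)
  · have := hp.simplyConnected
    exact existsUnique_isLiftedLengthMetric hp.isCoveringMap hX
  · obtain ⟨hcov, hsc⟩ := hp
    obtain ⟨htop, hlen, hiso⟩ := hm
    subst htop
    have : CompleteSpace E := hiso.completeSpace hcov hlen
    have hglob : IsLocallyConvexMetric X → IsGloballyConvexMetric E := fun h =>
      isGloballyConvexMetric_of_simplyConnected hlen (hiso.isLocallyConvexMetric h)
    refine ⟨fun h => ⟨hglob h, (hglob h).isUniquelyGeodesic⟩, fun h => IsCNOn.isCAT0 <|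
      isCNOn_univ_of_local (hglob h.isLocallyConvexMetric) fun e => ?_⟩
    obtain ⟨r, hr, h1⟩ := hiso.exists_ball e
    obtain ⟨r', hr', h2⟩ := h.exists_isCNOn_ball (p e)
    obtain ⟨h3, h4⟩ := h1 (min r r') (min_le_left _ _)
    exact ⟨_, Metric.ball_mem_nhds e (lt_min hr hr'),
      IsCNOn.of_image h3 (by rw [h4]; exact h2 _ (min_le_right _ _))⟩
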